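/- Let $S=\langle n_1,n_2,n_3\rangle=\{a_1n_1+a_2n_2+a_3n_3 : a_i\in\mathbb N\}$ be a symmetric numerical semigroup minimally generated by $n_1,n_2,n_3$ with $\gcd(n_1,n_2,n_3)=1$. (Symmetric: if $F=\max(\mathbb Z\setminus S)$, then $x\in\mathbb Z\setminus S$ implies $F-x\in S$.) For $s\in S$ let $\mathsf Z(s)=\{z\in\mathbb N^3: z_1n_1+z_2n_2+z_3n_3=s\}$, and for $v\in\mathbb Z^3$ let $\ell(v)=v_1+v_2+v_3$. Let $\Delta(s)$ be the set of differences of consecutive elements of $\mathsf L(s)=\{\ell(z): z\in\mathsf Z(s)\}$, and let $\Delta(S)=\bigcup_{s\in S}\Delta(s)$. Let $\mathrm{Betti}(S)$ be the set of those $s\in S$ for which the graph on $\mathsf Z(s)$, in which two distinct factorizations are joined when they have a common nonzero coordinate, is not connected. Let $M_S=\{v\in\mathbb Z^3: v_1n_1+v_2n_2+v_3n_3=0\}$. After a suitable permutation of the generators, vectors $v_1,v_2$ can be chosen as in (1) or (2): 1. $\#\mathrm{Betti}(S)=1$ and $(n_1,n_2,n_3)=(s_2s_3,s_1s_3,s_1s_2)$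 with pairwise coprime integers $s_1>s_2>s_3>0$; then $v_1=(s_1,-s_2,0)$ and $v_2=(0,s_2,-s_3)$. 2. $\#\mathrm{Betti}(S)=2$ and $(n_1,n_2,n_3)=(am_1,am_2,bm_1+cm_2)$ with nonnegative integers $a\ge2$, $b+c\ge2$, $m_1<m_2$ such that $\mathsf Z(am_1m_2)=\{(m_2,0,0),(0,m_1,0)\}$; then $v_1=(m_2,-m_1,0)$ and $v_2=(b+\lambda m_2,c-\lambda m_1,-a)$, where $\lambda\in\{-\lfloor b/m_2\rfloor,\dots,\lfloor c/m_1\rfloor\}$ is chosen so that $|\ell(v_2)|$ is minimal. For every such permutation and every such choice, $v_1,v_2$ is a basis of $M_S$, and with $\delta_1=\ell(v_1)>0$ and $\delta_2=|\ell(v_2)|$ one has $$\Delta(S)=\mathrm{Euc}(\delta_1,\delta_2)\setminus\{0\}.$$ Here, for positive integers $\delta_1,\delta_2$, put $\eta_1=\max\{\delta_1,\delta_2\}$, $\eta_2=\min\{\delta_1,\delta_2\}$, $\eta_{j+2}=\eta_j\bmod\eta_{j+1}$ as long as $\eta_{j+1}>0$; then $\mathrm{Euc}(\delta_1,\delta_2)$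 is the union, over all $j\ge1$ with $\eta_{j+1}>0$, of the sets $\{\eta_j-k\eta_{j+1}: 0\le k\le\lfloor\eta_j/\eta_{j+1}\rfloor\}$, that is, the set of all integers appearing in the subtractive Euclidean algorithm on $\delta_1,\delta_2$. If $\delta_2=0$, then $\mathrm{Euc}(\delta_1,0)=\{\delta_1,0\}$. -/

import Mathlib

namespace DeltaThree

/-- The submonoid `⟨n₁, n₂, n₃⟩` of `ℕ`. -/
def semigroup (n : Fin 3 → ℕ) : AddSubmonoid ℕ :=
  AddSubmonoid.closure (Set.range n)

/-- No generator is superfluous: `⟨n₁, n₂, n₃⟩` is minimally generated by `{n₁, n₂, n₃}`. -/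
def IsMinimalGen (n : Fin 3 → ℕ) : Prop :=
  ∀ i, n i ∉ AddSubmonoid.closure (n '' {i}ᶜ)

/-- The set `S` regarded as a set of integers. -/
def intSet (S : AddSubmonoid ℕ) : Set ℤ := (fun s : ℕ => (s : ℤ)) '' (S : Set ℕ)

/-- `S` is symmetric: with `F` the Frobenius number, i.e. the maximum of `ℤ \ S`,
`x ∈ ℤ \ S` implies `F - x ∈ S`. -/
def IsSymmetric (S : AddSubmonoid ℕ) : Prop :=
  ∃ F : ℤ, IsGreatest (intSet S)ᶜ F ∧ ∀ x : ℤ, x ∉ intSet S → F - x ∈ intSet S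

/-- The set `Z(s)` of factorizations of `s`. -/
def factorizations (n : Fin 3 → ℕ) (s : ℕ) : Set (Fin 3 → ℕ) :=
  {z | ∑ i, z i * n i = s}

/-- The set `L(s)` of lengths of factorizations of `s`. -/
def lengths (n : Fin 3 → ℕ) (s : ℕ) : Set ℕ :=
  (fun z : Fin 3 → ℕ => ∑ i, z i) '' factorizations n s

/-- The Delta set `Δ(s)`: the differences of consecutive elements of `L(s)`. -/
def deltaSetOf (n : Fin 3 → ℕ) (s : ℕ) : Set ℕ :=
  {d | ∃ l ∈ lengths n s, ∃ l' ∈ lengths n s,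
    l < l' ∧ (∀ k ∈ lengths n s, ¬ (l < k ∧ k < l')) ∧ d = l' - l}

/-- The Delta set `Δ(S)` of `S = ⟨n₁, n₂, n₃⟩`. -/
def deltaSet (n : Fin 3 → ℕ) : Set ℕ :=
  ⋃ s ∈ semigroup n, deltaSetOf n s

/-- The graph `∇_s` on `Z(s)`: two distinct factorizations are adjacent when they have a common
nonzero coordinate. -/
def factGraph (n : Fin 3 → ℕ) (s : ℕ) : SimpleGraph (factorizations n s) where
  Adj z z' := z ≠ z' ∧ ∃ i, z.1 i ≠ 0 ∧ z'.1 i ≠ 0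
  symm := ⟨fun _ _ h => ⟨h.1.symm, h.2.imp fun _ hi => ⟨hi.2, hi.1⟩⟩⟩
  loopless := ⟨fun _ h => h.1 rfl⟩

/-- The set of Betti elements of `S`. -/
def betti (n : Fin 3 → ℕ) : Set ℕ :=
  {s | s ∈ semigroup n ∧ ¬ (factGraph n s).Connected}

/-- The relation lattice `M_S`. -/
def relationLattice (n : Fin 3 → ℕ) : Submodule ℤ (Fin 3 → ℤ) where
  carrier := {v | ∑ i, v i * (n i : ℤ) = 0}
  zero_mem' := by simp
  add_mem' := by
    intro u v hu hv
    simp only [Set.mem_ofPred_eq, Pi.add_apply, add_mul, Finset.sum_add_distrib] at *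
    rw [hu, hv, add_zero]
  smul_mem' := by
    intro c v hv
    simp only [Set.mem_ofPred_eq, Pi.smul_apply, smul_eq_mul, mul_assoc] at *
    rw [← Finset.mul_sum, hv, mul_zero]

/-- The length `ℓ(v) = v₁ + v₂ + v₃`. -/
def ell (v : Fin 3 → ℤ) : ℤ := ∑ i, v i

/-- The choice of `v₁, v₂` when there is a single Betti element. -/
def IsSingleBettiBasis (n : Fin 3 → ℕ) (v₁ v₂ : Fin 3 → ℤ) : Prop :=
  (betti n).ncard = 1 ∧
  ∃ s₁ s₂ s₃ : ℕ, 0 < s₃ ∧ s₃ < s₂ ∧ s₂ < s₁ ∧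
    s₁.Coprime s₂ ∧ s₁.Coprime s₃ ∧ s₂.Coprime s₃ ∧
    n = ![s₂ * s₃, s₁ * s₃, s₁ * s₂] ∧
    v₁ = ![(s₁ : ℤ), -(s₂ : ℤ), 0] ∧
    v₂ = ![0, (s₂ : ℤ), -(s₃ : ℤ)]

/-- The vector `(b + k m₂, c - k m₁, -a)`. -/
def shiftVec (a b c m₁ m₂ : ℕ) (k : ℤ) : Fin 3 → ℤ :=
  ![(b : ℤ) + k * m₂, (c : ℤ) - k * m₁, -(a : ℤ)]

/-- The choice of `v₁, v₂` when there are two Betti elements, `a (b m₁ + c m₂)` and `a m₁ m₂`,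
the second one having exactly the two factorizations `(m₂, 0, 0)` and `(0, m₁, 0)`.
Among the `k` with `-⌊b / m₂⌋ ≤ k ≤ ⌊c / m₁⌋`, i.e. those for which `(b + k m₂, c - k m₁, 0)` is
a factorization of the first one, `k` minimizes the absolute value of the length of
`(b + k m₂, c - k m₁, -a)`. -/
def IsTwoBettiBasis (n : Fin 3 → ℕ) (v₁ v₂ : Fin 3 → ℤ) : Prop :=
  (betti n).ncard = 2 ∧
  ∃ a b c m₁ m₂ : ℕ, 2 ≤ a ∧ 2 ≤ b + c ∧ m₁ < m₂ ∧
    n = ![a * m₁, a * m₂, b * m₁ + c * m₂] ∧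
    factorizations n (a * m₁ * m₂) = {![m₂, 0, 0], ![0, m₁, 0]} ∧
    v₁ = ![(m₂ : ℤ), -(m₁ : ℤ), 0] ∧
    ∃ k ∈ Set.Icc (-((b / m₂ : ℕ) : ℤ)) ((c / m₁ : ℕ) : ℤ),
      (∀ k' ∈ Set.Icc (-((b / m₂ : ℕ) : ℤ)) ((c / m₁ : ℕ) : ℤ),
        |ell (shiftVec a b c m₁ m₂ k)| ≤ |ell (shiftVec a b c m₁ m₂ k')|) ∧
      v₂ = shiftVec a b c m₁ m₂ k

/-- `v₁, v₂` are the chosen vectors for the generators in the order `n₁, n₂, n₃`. -/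
def IsChosenBasis (n : Fin 3 → ℕ) (v₁ v₂ : Fin 3 → ℤ) : Prop :=
  IsSingleBettiBasis n v₁ v₂ ∨ IsTwoBettiBasis n v₁ v₂

/-- The remainder sequence `max, min, max mod min, …` of Euclid's algorithm (indexed from `0`). -/
def eta (δ₁ δ₂ : ℕ) : ℕ → ℕ
  | 0 => max δ₁ δ₂
  | 1 => min δ₁ δ₂
  | j + 2 => eta δ₁ δ₂ j % eta δ₁ δ₂ (j + 1)

/-- The set `D(η_j, η_{j+1}) = {η_j, η_j - η_{j+1}, …, η_j mod η_{j+1}}`, where the first element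
`η_j` is listed only in the first two of these sets. -/
def eucStep (δ₁ δ₂ j : ℕ) : Set ℕ :=
  {x | ∃ k : ℕ, (j < 2 ∨ 1 ≤ k) ∧ k ≤ eta δ₁ δ₂ j / eta δ₁ δ₂ (j + 1) ∧
    x = eta δ₁ δ₂ j - k * eta δ₁ δ₂ (j + 1)}

/-- Euclid's set: all the integers that appear in the subtractive Euclidean algorithm. If one of
the two numbers is `0`, the algorithm stops at once and only the two numbers themselves appear. -/
def Euc (δ₁ δ₂ : ℕ) : Set ℕ :=
  if δ₁ = 0 ∨ δ₂ = 0 then {δ₁, δ₂}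
  else ⋃ j ∈ {j : ℕ | 0 < eta δ₁ δ₂ (j + 1)}, eucStep δ₁ δ₂ j

end DeltaThree

namespace DeltaThree

/-! Write `v⁻` for the negative part of a relation `v`. By `mem_deltaSet_iff`, the Delta set
consists of the lengths `ℓ(v) > 0` of relations `v` such that no relation `w ≥ -v⁻` has `0 < ℓ(w) <
ℓ(v)`. The Delta set is thus read off from the lattice `M_S`.

Euclid's set has a parallel description (`mem_Euc_diff_zero_iff`): its nonzero elements are the
positive values of `i δ₁ - j δ₂` or `j δ₂ - i δ₁` with `i, j ≥ 0` that are minimal among the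
positive values of the same form with coefficients in the box below `(i, j)`. This minimality obeys
the recursion of the subtractive algorithm (`isBoxComb_add`).

The two descriptions are matched through `v = i v₁ + j v₂`, where `v₁ = (m₂, -m₁, 0)` and `v₂ = (p,
q, -a)` with `p, q ≥ 0`. If `v` splits, with compatible signs of coefficients, into two parts of
positive length, then one part is a competitor of `v`; so irreducible lengths are box-minimal
(`IsIrred.isBoxComb`). Conversely, a competitor outside the box is excluded by its signs and length,
up to a few boundary cases. Those are removed by `IsReduced`, which follows from the minimality of
`|ℓ(v₂)|` and from `a m₁ m₂` having only two factorizations.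

For existence, symmetry makes every element of the Apéry set of a generator a summand of its maximum
`W`. Comparing the critical multiples of the generators with `W` shows that `S` is a gluing
(`exists_gluing_of_isSymmetric`). A gluing can be reordered or regrouped into form (1) or (2)
(`hasChosenBasis_of_gluing`). -/

/-! ### Euclid's set as the set of box-minimal combinations -/

/-- `d > 0` is a combination `i α - j β` such that no smaller positive combination has
coefficients bounded by `i` and `j`. -/
def IsMinComb (α β d : ℤ) : Prop :=
  0 < d ∧ ∃ i j : ℤ, 0 ≤ i ∧ 0 ≤ j ∧ i * α - j * β = d ∧
    ∀ i' j' : ℤ, 0 ≤ i' → i' ≤ i → 0 ≤ j' → j' ≤ j → 0 < i' * α - j' * β → d ≤ i' * α - j' * β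

lemma IsMinComb.le {α β d : ℤ} (hα : 0 ≤ α) (hβ : 0 ≤ β) (h : IsMinComb α β d) : d ≤ α := by
  obtain ⟨hd, i, j, hi, hj, e, hm⟩ := h
  have hi0 : i ≠ 0 := by rintro rfl; nlinarith
  have hα0 : α ≠ 0 := by rintro rfl; nlinarith
  have := hm 1 0 (by lia) (by lia) le_rfl hj (by lia)
  lia

lemma isMinComb_self {α : ℤ} (β : ℤ) (hα : 0 < α) : IsMinComb α β α := by
  refine ⟨hα, 1, 0, by lia, le_rfl, by ring, ?_⟩
  intro i' j' h0 h1 h2 h3 h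
  obtain rfl : j' = 0 := by lia
  obtain rfl | rfl : i' = 0 ∨ i' = 1 := by lia
  · simp at h
  · simp

/-- Since `i (x + y) - j y = i x - (j - i) y`, the coefficients change by a shear. The sheared box
is larger than the old one, but the extra pairs give values that are at least `x ≥ d` or negative.
-/
lemma IsMinComb.add_left {x y d : ℤ} (hx : 0 ≤ x) (hy : 0 < y) (h : IsMinComb x y d) :
    IsMinComb (x + y) y d := by
  have hle := h.le hx hy.le
  obtain ⟨hd, i, j, hi, hj, e, hm⟩ := h
  refine ⟨hd, i, j + i, hi, by lia, by rw [← e]; ring, ?_⟩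
  intro i' j' h0 h1 h2 h3 h
  have e2 : i' * (x + y) - j' * y = i' * x - (j' - i') * y := by ring
  rw [e2] at h ⊢
  by_contra hc
  rcases lt_or_ge j' i' with hji | hji
  · have : x ≤ i' * x := by nlinarith
    nlinarith
  rcases le_or_gt (j' - i') j with hb | hb
  · exact hc (hm i' (j' - i') h0 h1 (by lia) hb h)
  · have : (i - i') * x ≥ x := by nlinarith
    nlinarith

lemma IsMinComb.add_right {x y d : ℤ} (hx : 0 ≤ x) (hy : 0 < y) (h : IsMinComb y x d) :
    IsMinComb y (x + y) d := by
  obtain ⟨hd, i, j, hi, hj, e, hm⟩ := h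
  refine ⟨hd, i + j, j, by lia, hj, by rw [← e]; ring, ?_⟩
  intro i' j' h0 h1 h2 h3 h
  have e2 : i' * y - j' * (x + y) = (i' - j') * y - j' * x := by ring
  rw [e2] at h ⊢
  have hji : j' < i' := by nlinarith
  rcases le_or_gt (i' - j') i with hb | hb
  · exact hm _ _ (by lia) hb h2 h3 h
  · nlinarith

lemma IsMinComb.of_add_left {x y d : ℤ} (hx : 0 ≤ x) (hy : 0 < y) (h : IsMinComb (x + y) y d) :
    d = x + y ∨ IsMinComb x y d := by
  have hle := h.le (by lia) hy.le
  obtain ⟨hd, i, j, hi, hj, e, hm⟩ := h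
  rcases le_or_gt i j with hij | hij
  · right
    refine ⟨hd, i, j - i, hi, by lia, by rw [← e]; ring, ?_⟩
    intro i' j' h0 h1 h2 h3 h
    have := hm i' (j' + i') h0 h1 (by lia) (by lia) (by linarith)
    linarith
  · left
    nlinarith

lemma IsMinComb.of_add_right {x y d : ℤ} (hx : 0 ≤ x) (hy : 0 < y) (h : IsMinComb y (x + y) d) :
    IsMinComb y x d := by
  obtain ⟨hd, i, j, hi, hj, e, hm⟩ := h
  have hij : j < i := by nlinarith
  refine ⟨hd, i - j, j, by lia, hj, by rw [← e]; ring, ?_⟩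
  intro i' j' h0 h1 h2 h3 h
  have := hm (i' + j') j' (by lia) (by lia) h2 h3 (by linarith)
  linarith

/-- `d` is a box-minimal combination of `α` and `β`, with either sign pattern. -/
def IsBoxComb (α β d : ℤ) : Prop := IsMinComb α β d ∨ IsMinComb β α d

lemma isBoxComb_comm {α β d : ℤ} : IsBoxComb α β d ↔ IsBoxComb β α d := Or.comm

/-- One subtractive step of Euclid's algorithm: it emits `x + y` and passes to the pair `(x, y)`. -/
lemma isBoxComb_add {x y d : ℤ} (hx : 0 ≤ x) (hy : 0 < y) :
    IsBoxComb (x + y) y d ↔ d = x + y ∨ IsBoxComb x y d := by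
  constructor
  · rintro (h | h)
    · exact (h.of_add_left hx hy).imp_right Or.inl
    · exact Or.inr (Or.inr (h.of_add_right hx hy))
  · rintro (rfl | h | h)
    · exact Or.inl (isMinComb_self _ (by lia))
    · exact Or.inl (h.add_left hx hy)
    · exact Or.inr (h.add_right hx hy)

lemma isBoxComb_add_mul {x y d : ℤ} (hx : 0 ≤ x) (hy : 0 < y) (k : ℕ) :
    IsBoxComb (x + k * y) y d ↔ (∃ t : ℕ, t < k ∧ d = x + (t + 1) * y) ∨ IsBoxComb x y d := by
  induction k with
  | zero => simp
  | succ k ih =>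
    have e : x + ((k + 1 : ℕ) : ℤ) * y = x + k * y + y := by push_cast; ring
    rw [e, isBoxComb_add (by positivity) hy, ih]
    constructor
    · rintro (h | ⟨t, ht, h⟩ | h)
      · exact Or.inl ⟨k, by lia, by rw [h]; ring⟩
      · exact Or.inl ⟨t, by lia, h⟩
      · exact Or.inr h
    · rintro (⟨t, ht, h⟩ | h)
      · rcases Nat.lt_succ_iff_lt_or_eq.mp ht with h' | rfl
        · exact Or.inr (Or.inl ⟨t, h', h⟩)
        · exact Or.inl (by rw [h]; ring)
      · exact Or.inr (Or.inr h)

lemma isBoxComb_zero_right {x d : ℤ} (hx : 0 < x) : IsBoxComb x 0 d ↔ d = x := by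
  constructor
  · rintro (⟨hd, i, j, hi, hj, e, hm⟩ | ⟨hd, i, j, hi, hj, e, hm⟩)
    · have hi0 : 0 < i := by
        rcases hi.eq_or_lt with rfl | h
        · simp at e; lia
        · exact h
      have h1 := hm 1 0 (by lia) (by lia) le_rfl hj (by lia)
      nlinarith
    · nlinarith
  · rintro rfl
    exact Or.inl (isMinComb_self _ hx)

lemma eta_comm (x y j : ℕ) : eta x y j = eta y x j := by
  induction j using Nat.twoStepInduction with
  | zero => simp [eta, max_comm]
  | one => simp [eta, min_comm]
  | more j h1 h2 => simp [eta, h1, h2]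

lemma Euc_comm (x y : ℕ) : Euc x y = Euc y x := by
  unfold Euc eucStep
  simp only [eta_comm x y, or_comm, Set.pair_comm]

lemma eta_shift {x y : ℕ} (hy : 0 < y) (hyx : y ≤ x) (j : ℕ) :
    eta x y (j + 1) = eta y (x % y) j := by
  have := Nat.mod_lt x hy
  induction j using Nat.twoStepInduction with
  | zero => simp only [eta]; lia
  | one => simp only [eta, max_eq_left hyx, min_eq_right hyx, min_eq_right this.le]
  | more j h1 h2 =>
    change eta x y (j + 1) % eta x y (j + 1 + 1) = _
    rw [h1, h2]; rfl

/-- Because `y % 0 = y`, the sequence does not stay at `0` after termination but runs `y, 0, y, 0,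
…`. This lemma serves to show that those later indices contribute nothing to Euclid's set. -/
lemma eta_zero_alternating (y j : ℕ) : eta y 0 j = 0 ∨ eta y 0 (j + 1) = 0 := by
  induction j with
  | zero => right; simp [eta]
  | succ j ih =>
    rcases ih with h | h
    · right
      change eta y 0 j % eta y 0 (j + 1) = 0
      rw [h, Nat.zero_mod]
    · exact Or.inl h

lemma mem_Euc_iff_of_le {x y d : ℕ} (hy : 0 < y) (hyx : y ≤ x) :
    d ∈ Euc x y ↔ (∃ k ≤ x / y, d = x - k * y) ∨ d ∈ Euc y (x % y) := by
  have h0 : eta x y 0 = x := by simp only [eta]; lia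
  have h1 : eta x y 1 = y := by simp only [eta]; lia
  have key : d ∈ Euc x y ↔ (∃ k ≤ x / y, d = x - k * y) ∨
      ∃ j, 0 < eta y (x % y) (j + 1) ∧ ∃ k, (j + 1 < 2 ∨ 1 ≤ k) ∧
        k ≤ eta y (x % y) j / eta y (x % y) (j + 1) ∧
        d = eta y (x % y) j - k * eta y (x % y) (j + 1) := by
    have hne : ¬ (x = 0 ∨ y = 0) := by lia
    simp only [Euc, if_neg hne, Set.mem_iUnion, Set.mem_ofPred_eq, eucStep, exists_prop]
    constructor
    · rintro ⟨j, hj, k, hk, hle, he⟩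
      cases j with
      | zero => left; rw [zero_add, h0, h1] at *; exact ⟨k, hle, he⟩
      | succ j =>
        right
        rw [eta_shift hy hyx (j + 1)] at *
        rw [eta_shift hy hyx j] at *
        exact ⟨j, hj, k, hk, hle, he⟩
    · rintro (⟨k, hk, he⟩ | ⟨j, hj, k, hk, hle, he⟩)
      · refine ⟨0, ?_, k, by simp, ?_, ?_⟩ <;> simp only [zero_add, h0, h1] <;> assumption
      · refine ⟨j + 1, ?_, k, hk, ?_, ?_⟩ <;>
          simp only [eta_shift hy hyx (j + 1), eta_shift hy hyx j] <;> assumption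
  rw [key]
  rcases Nat.eq_zero_or_pos (x % y) with hr | hr
  · rw [hr]
    simp only [Euc, or_true, if_true, Set.mem_insert_iff, Set.mem_singleton_iff]
    have hxy := Nat.div_add_mod x y
    have hpos : 0 < x / y := Nat.div_pos hyx hy
    constructor
    · rintro (h | ⟨j, hj, k, hk, hle, he⟩)
      · exact Or.inl h
      · exfalso
        -- A stray index has `η_j = 0`, which leaves only `k = 0`, and that is excluded past the
        -- first two steps.
        rcases eta_zero_alternating y j with h | h
        · cases j with
          | zero => simp [eta] at h; lia
          | succ j =>
            rw [h, Nat.zero_div] at hle; lia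
        · lia
    · rintro (h | h | h)
      · exact Or.inl h
      · refine Or.inl ⟨x / y - 1, by lia, ?_⟩
        obtain ⟨t, ht⟩ : ∃ t, x / y = t + 1 := ⟨x / y - 1, by lia⟩
        rw [ht] at hxy ⊢
        rw [h, Nat.add_sub_cancel]
        have : y * (t + 1) = t * y + y := by ring
        lia
      · refine Or.inl ⟨x / y, le_rfl, ?_⟩
        rw [mul_comm] at hxy; lia
  · have hne : ¬ (y = 0 ∨ x % y = 0) := by lia
    simp only [Euc, if_neg hne, Set.mem_iUnion, Set.mem_ofPred_eq, eucStep, exists_prop]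
    constructor
    · rintro (h | ⟨j, hj, k, hk, hle, he⟩)
      · exact Or.inl h
      · exact Or.inr ⟨j, hj, k, by lia, hle, he⟩
    · rintro (h | ⟨j, hj, k, hk, hle, he⟩)
      · exact Or.inl h
      · by_cases hc : j + 1 < 2 ∨ 1 ≤ k
        · exact Or.inr ⟨j, hj, k, hc, hle, he⟩
        -- The shift of index loses only the leading element `x % y` of one list, which is already
        -- the last element of the first list.
        · obtain ⟨rfl, rfl⟩ : j = 1 ∧ k = 0 := by lia
          refine Or.inl ⟨x / y, le_rfl, ?_⟩
          have hxy := Nat.div_add_mod x y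
          have := Nat.mod_lt x hy
          have h2 : eta y (x % y) 1 = x % y := by simp only [eta]; lia
          rw [he, h2]
          rw [mul_comm] at hxy; lia

/-- The nonzero elements of Euclid's set are the box-minimal combinations. -/
theorem mem_Euc_diff_zero_iff {x y : ℕ} (hx : 0 < x) (d : ℕ) :
    d ∈ Euc x y \ {0} ↔ IsBoxComb x y d := by
  have main : ∀ y x : ℕ, y ≤ x → 0 < x → (d ∈ Euc x y \ {0} ↔ IsBoxComb x y d) := by
    intro y
    induction y using Nat.strong_induction_on with
    | _ y ih =>
      intro x hyx hx
      rcases Nat.eq_zero_or_pos y with rfl | hy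
      · rw [Nat.cast_zero, isBoxComb_zero_right (by exact_mod_cast hx)]
        simp only [Euc, or_true, if_true, Set.mem_sdiff, Set.mem_insert_iff, Set.mem_singleton_iff]
        lia
      · have hlt := Nat.mod_lt x hy
        have IH := ih (x % y) hlt y hlt.le hy
        have hxy := Nat.div_add_mod x y
        have e : (x : ℤ) = ((x % y : ℕ) : ℤ) + (x / y : ℕ) * (y : ℤ) := by
          conv_lhs => rw [← hxy]
          push_cast; ring
        conv_rhs => rw [e]
        rw [isBoxComb_add_mul (by positivity) (by exact_mod_cast hy),
          isBoxComb_comm (α := (x % y : ℕ)), ← IH, Set.mem_sdiff,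
          mem_Euc_iff_of_le hy hyx, Set.mem_sdiff, Set.mem_singleton_iff]
        constructor
        · rintro ⟨⟨k, hk, he⟩ | h, hd⟩
          · rcases hk.eq_or_lt with rfl | hk'
            · right
              have hdr : d = x % y := by rw [he, mul_comm]; lia
              refine (Set.mem_sdiff _).mp (IH.mpr (Or.inr ?_))
              rw [hdr]
              exact isMinComb_self _ (by lia)
            · left
              obtain ⟨t, ht⟩ : ∃ t, x / y = k + (t + 1) := ⟨x / y - k - 1, by lia⟩
              refine ⟨t, by lia, ?_⟩
              rw [ht] at hxy
              have : d = x % y + (t + 1) * y := by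
                rw [he]
                have : y * (k + (t + 1)) = k * y + (t + 1) * y := by ring
                lia
              rw [this]; push_cast; ring
          · exact Or.inr ⟨h, hd⟩
        · rintro (⟨t, ht, he⟩ | ⟨h, hd⟩)
          · obtain ⟨k, hk⟩ : ∃ k, x / y = k + (t + 1) := ⟨x / y - (t + 1), by lia⟩
            have hd : d = x % y + (t + 1) * y := by exact_mod_cast he
            have hpos : 0 < (t + 1) * y := by positivity
            refine ⟨Or.inl ⟨k, by lia, ?_⟩, by lia⟩
            rw [hk] at hxy
            have : y * (k + (t + 1)) = k * y + (t + 1) * y := by ring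
            lia
          · exact ⟨Or.inr h, hd⟩
  rcases le_total y x with h | h
  · exact main y x h hx
  · rw [Euc_comm, isBoxComb_comm]
    exact main x y h (by lia)

/-! ### Irreducible relations and box-minimal combinations -/

/-- The length of `i v₁ + j v₂` for `v₁ = (m₂, -m₁, 0)` and `v₂ = (p, q, -a)`. -/
def planeLen (m₁ m₂ p q a i j : ℤ) : ℤ := i * (m₂ - m₁) + j * (p + q - a)

/-- With `v = i v₁ + j v₂` and `v⁻` its negative part, no relation `w ≥ -v⁻` satisfies
`0 < ℓ(w) < ℓ(v)`. -/
def IsIrred (m₁ m₂ p q a i j : ℤ) : Prop :=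
  ∀ i' j' : ℤ, min (i * m₂ + j * p) 0 ≤ i' * m₂ + j' * p →
    min (-(i * m₁) + j * q) 0 ≤ -(i' * m₁) + j' * q →
    min (-(j * a)) 0 ≤ -(j' * a) →
    0 < planeLen m₁ m₂ p q a i' j' →
    planeLen m₁ m₂ p q a i j ≤ planeLen m₁ m₂ p q a i' j'

section
variable {m₁ m₂ p q a : ℤ}

/-- An irreducible relation is not a sum of two relations of positive length whose coordinates
have compatible signs. -/
lemma IsIrred.not_split (hm₁ : 0 < m₁) (hm₂ : 0 < m₂) (hp : 0 ≤ p) (hq : 0 ≤ q) (ha : 0 < a)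
    {i₁ j₁ i₂ j₂ : ℤ} (h : IsIrred m₁ m₂ p q a (i₁ + i₂) (j₁ + j₂))
    (hi : (0 ≤ i₁ ∧ 0 ≤ i₂) ∨ (i₁ ≤ 0 ∧ i₂ ≤ 0)) (hj : (0 ≤ j₁ ∧ 0 ≤ j₂) ∨ (j₁ ≤ 0 ∧ j₂ ≤ 0))
    (h₁ : 0 < planeLen m₁ m₂ p q a i₁ j₁) : planeLen m₁ m₂ p q a i₂ j₂ ≤ 0 := by
  by_contra! h₂
  have e : planeLen m₁ m₂ p q a (i₁ + i₂) (j₁ + j₂) =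
    planeLen m₁ m₂ p q a i₁ j₁ + planeLen m₁ m₂ p q a i₂ j₂ := by unfold planeLen; ring
  have A := h i₁ j₁
  have B := h i₂ j₂
  rw [e] at A B
  have sgn : ∀ {x y c : ℤ}, 0 ≤ c → ((0 ≤ x ∧ 0 ≤ y) ∨ (x ≤ 0 ∧ y ≤ 0)) →
      (0 ≤ x → 0 ≤ x * c) ∧ (x ≤ 0 → x * c ≤ 0) ∧ (0 ≤ y → 0 ≤ y * c) ∧ (y ≤ 0 → y * c ≤ 0) :=
    fun hc _ => ⟨fun h => mul_nonneg h hc, fun h => mul_nonpos_of_nonpos_of_nonneg h hc,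
      fun h => mul_nonneg h hc, fun h => mul_nonpos_of_nonpos_of_nonneg h hc⟩
  have s1 := sgn hm₁.le hi
  have s2 := sgn hm₂.le hi
  have s3 := sgn hp hj
  have s4 := sgn hq hj
  have s5 := sgn ha.le hj
  simp only [add_mul] at A B
  generalize planeLen m₁ m₂ p q a i₁ j₁ = l₁ at *
  generalize planeLen m₁ m₂ p q a i₂ j₂ = l₂ at *
  clear h sgn e
  generalize i₁ * m₁ = x1 at *
  generalize i₂ * m₁ = x2 at *
  generalize i₁ * m₂ = x3 at *
  generalize i₂ * m₂ = x4 at *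
  generalize j₁ * p = x5 at *
  generalize j₂ * p = x6 at *
  generalize j₁ * q = x7 at *
  generalize j₂ * q = x8 at *
  generalize j₁ * a = x9 at *
  generalize j₂ * a = x10 at *
  -- With the given signs, at most one coordinate receives contributions of opposite signs. If the
  -- first part falls below the bound there, the second part is positive in that coordinate, so one
  -- of the two parts is always a competitor.
  by_cases hA : min (x3 + x4 + (x5 + x6)) 0 ≤ x3 + x5 ∧ min (-(x1 + x2) + (x7 + x8)) 0 ≤ -x1 + x7 ∧
      min (-(x9 + x10)) 0 ≤ -x9
  · have := A hA.1 hA.2.1 hA.2.2 h₁; lia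
  · have hB : min (x3 + x4 + (x5 + x6)) 0 ≤ x4 + x6 ∧ min (-(x1 + x2) + (x7 + x8)) 0 ≤ -x2 + x8 ∧
      min (-(x9 + x10)) 0 ≤ -x10 := by
      clear A B
      rcases hi with hi | hi <;> rcases hj with hj | hj <;>
        simp only [hi, hj, true_imp_iff] at * <;> lia
    have := B hB.1 hB.2.1 hB.2.2 h₂; lia

/-- The length of an irreducible relation is a box-minimal combination. -/
theorem IsIrred.isBoxComb (hm₁ : 0 < m₁) (hm : m₁ < m₂) (hp : 0 ≤ p) (hq : 0 ≤ q) (ha : 0 < a)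
    {i j : ℤ} (h : IsIrred m₁ m₂ p q a i j) (hpos : 0 < planeLen m₁ m₂ p q a i j) :
    IsBoxComb (m₂ - m₁) |p + q - a| (planeLen m₁ m₂ p q a i j) := by
  -- The sign of `ℓ(v₂)` is absorbed into `j`, so that both basis lengths become nonnegative.
  obtain ⟨ε, hε, hβ⟩ : ∃ ε : ℤ, (ε = 1 ∨ ε = -1) ∧ p + q - a = ε * |p + q - a| := by
    rcases abs_choice (p + q - a) with h | h
    · exact ⟨1, Or.inl rfl, by rw [h]; ring⟩
    · exact ⟨-1, Or.inr rfl, by rw [h]; ring⟩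
  have hδ := abs_nonneg (p + q - a)
  generalize |p + q - a| = δ at *
  have hεε : ε * ε = 1 := by rcases hε with rfl | rfl <;> rfl
  obtain ⟨J, rfl⟩ : ∃ J, j = ε * J := ⟨ε * j, by rw [← mul_assoc, hεε, one_mul]⟩
  have hlen : ∀ i' j', planeLen m₁ m₂ p q a i' (ε * j') = i' * (m₂ - m₁) + j' * δ := by
    intro i' j'
    unfold planeLen
    rw [hβ]
    linear_combination (j' * δ) * hεε
  have split : ∀ i₁ J₁ i₂ J₂, i = i₁ + i₂ → J = J₁ + J₂ →
      ((0 ≤ i₁ ∧ 0 ≤ i₂) ∨ (i₁ ≤ 0 ∧ i₂ ≤ 0)) → ((0 ≤ J₁ ∧ 0 ≤ J₂) ∨ (J₁ ≤ 0 ∧ J₂ ≤ 0)) →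
      0 < i₁ * (m₂ - m₁) + J₁ * δ → i₂ * (m₂ - m₁) + J₂ * δ ≤ 0 := by
    rintro i₁ J₁ i₂ J₂ rfl rfl hi hJ h₁
    rw [← hlen] at h₁ ⊢
    rw [mul_add] at h
    refine h.not_split hm₁ (hm₁.trans hm) hp hq ha hi ?_ h₁
    rcases hε with rfl | rfl <;> lia
  rw [hlen] at hpos ⊢
  have hα0 : 0 < m₂ - m₁ := by lia
  clear hlen
  generalize m₂ - m₁ = α at *
  -- If both coefficients are nonnegative, a copy of one basis vector can be split off, which leaves
  -- only `α` or `δ` as the length. If they have opposite signs, every pair in the box gives a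
  -- compatible splitting, which is box-minimality.
  rcases le_total 0 i with hi | hi <;> rcases le_total 0 J with hJ | hJ
  · rcases hi.eq_or_lt with rfl | hi
    · have hJ0 : J ≠ 0 := by rintro rfl; simp at hpos
      have hδ0 : 0 < δ := by nlinarith
      obtain rfl : J = 1 := by
        by_contra hne
        have := split 0 1 0 (J - 1) (by lia) (by lia) (by lia) (by lia) (by lia)
        nlinarith [show 1 ≤ J - 1 by lia]
      rw [zero_mul, zero_add, one_mul]
      exact Or.inr (isMinComb_self α hδ0)
    · have := split 1 0 (i - 1) J (by lia) (by lia) (by lia) (by lia) (by lia)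
      have h1 : 0 ≤ (i - 1) * α := mul_nonneg (by lia) hα0.le
      have h2 : 0 ≤ J * δ := mul_nonneg hJ hδ
      have : i * α + J * δ = α := by linarith
      rw [this]
      exact Or.inl (isMinComb_self δ hα0)
  · refine Or.inl ⟨hpos, i, -J, hi, by lia, by ring, ?_⟩
    intro i' j' h0 h1 h2 h3 hp'
    have := split i' (-j') (i - i') (J + j') (by lia) (by lia) (by lia) (by lia) (by linarith)
    linarith
  · refine Or.inr ⟨hpos, J, -i, hJ, by lia, by ring, ?_⟩
    intro i' j' h0 h1 h2 h3 hp'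
    have := split (-j') i' (i + j') (J - i') (by lia) (by lia) (by lia) (by lia) (by linarith)
    linarith
  · have h1 := mul_nonpos_of_nonpos_of_nonneg hi hα0.le
    have h2 := mul_nonpos_of_nonpos_of_nonneg hJ hδ
    lia

/-- For `v = i v₁ - J v₂`, the signs of the last two coordinates give `J' ≥ 0` and `i' m₁ + J' q ≤ i
m₁ + J q` for a competitor `i' v₁ - J' v₂`. Outside the box this leaves only `i' = i`, `J' > J`, `q
= 0`, where `m₂ < p` forces `i ≥ J + 2` and hence `ℓ(v₂) > ℓ(v₁)`, contradicting `h1`. -/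
lemma exists_isIrred_of_isMinComb_of_nonneg (hm₁ : 0 < m₁) (hm : m₁ < m₂) (hp : 0 ≤ p)
    (hq : 0 ≤ q) (ha : 0 < a) (hβ : 0 ≤ p + q - a) (h1 : m₂ - m₁ < p + q - a → p < m₂)
    (h2 : q = 0 → m₂ < p) {d : ℤ} (hd : IsMinComb (m₂ - m₁) (p + q - a) d) :
    ∃ i j, planeLen m₁ m₂ p q a i j = d ∧ IsIrred m₁ m₂ p q a i j := by
  have hle := hd.le (by lia) hβ
  obtain ⟨hd0, i, J, hi, hJ, e, hmin⟩ := hd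
  have eL : planeLen m₁ m₂ p q a i (-J) = d := by unfold planeLen; rw [← e]; ring
  refine ⟨i, -J, eL, ?_⟩
  intro i' j' c1 c2 c3 hpos
  rw [eL]
  by_contra! hlt
  obtain ⟨J', rfl⟩ : ∃ J', j' = -J' := ⟨-j', by ring⟩
  unfold planeLen at hpos hlt
  have hα0 : 0 < m₂ - m₁ := by lia
  have hβ0 := hβ
  have hm₂ : 0 < m₂ := by lia
  generalize m₂ - m₁ = α at *
  generalize p + q - a = β at *
  have hJa : 0 ≤ J * a := by positivity
  have hJ' : 0 ≤ J' := by
    rw [min_eq_right (by linarith)] at c3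
    by_contra! hc
    nlinarith
  have hi' : 0 < i' := by
    by_contra! hc
    nlinarith [mul_nonneg hJ' hβ0]
  rcases le_or_gt i' i with hii | hii <;> rcases le_or_gt J' J with hJJ | hJJ
  · have := hmin i' J' hi'.le hii hJ' hJJ (by linarith)
    linarith
  · rcases hii.eq_or_lt with rfl | hii
    · have hq0 : q = 0 := by
        by_contra hne
        have : 0 ≤ J * q := by positivity
        have : 0 < i' * m₁ := by positivity
        rw [min_eq_left (by linarith)] at c2
        have : 0 < q := by lia
        nlinarith
      have hmp := h2 hq0
      have c1' : 0 ≤ i' * m₂ + -J' * p := by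
        rcases min_le_iff.mp c1 with h | h
        · nlinarith
        · exact h
      have hiJ : J + 2 ≤ i' := by
        have : J' < i' := by
          by_contra! hc
          nlinarith
        lia
      have : α < β := by
        by_contra! hc
        nlinarith [mul_nonneg hJ (sub_nonneg.mpr hc), mul_nonneg (sub_nonneg.mpr hiJ) hα0.le]
      have := h1 this
      lia
    · nlinarith [mul_nonneg (sub_nonneg.mpr hJJ.le) hβ0]
  · nlinarith [mul_nonneg (sub_nonneg.mpr hJJ) hβ0]
  · have : 0 ≤ J * q := by positivity
    have : 0 ≤ i * m₁ := by positivity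
    rw [min_eq_left (by linarith)] at c2
    nlinarith

/-- Here `v = -I v₁ + J v₂`, and the one competitor outside the box not settled by its length is `J'
= J`, `I' > I`. Its first coordinate gives `I' m₂ ≤ J p`, and `p < m₂` then makes `d` exceed
`ℓ(v₂)`. -/
lemma exists_isIrred_of_isMinComb_swap_of_nonneg (hm₁ : 0 < m₁) (hm : m₁ < m₂)
    (hq : 0 ≤ q) (ha : 0 < a) (hβ : 0 ≤ p + q - a) (h1 : m₂ - m₁ < p + q - a → p < m₂)
    {d : ℤ} (hd : IsMinComb (p + q - a) (m₂ - m₁) d) :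
    ∃ i j, planeLen m₁ m₂ p q a i j = d ∧ IsIrred m₁ m₂ p q a i j := by
  have hle := hd.le hβ (by lia)
  obtain ⟨hd0, J, I, hJ, hI, e, hmin⟩ := hd
  have eL : planeLen m₁ m₂ p q a (-I) J = d := by unfold planeLen; rw [← e]; ring
  refine ⟨-I, J, eL, ?_⟩
  intro i' J' c1 c2 c3 hpos
  rw [eL]
  by_contra! hlt
  obtain ⟨I', rfl⟩ : ∃ I', i' = -I' := ⟨-i', by ring⟩
  unfold planeLen at hpos hlt
  have hα0 : 0 < m₂ - m₁ := by lia
  have hβ0 := hβ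
  have hm₂ : 0 < m₂ := by lia
  generalize m₂ - m₁ = α at *
  generalize p + q - a = β at *
  have hJJ : J' ≤ J := by
    have : 0 ≤ J * a := by positivity
    rw [min_eq_left (by linarith)] at c3
    by_contra! hc
    nlinarith
  have c2' : 0 ≤ I' * m₁ + J' * q := by
    have : 0 ≤ J * q := by positivity
    have : 0 ≤ I * m₁ := by positivity
    rw [min_eq_right (by linarith)] at c2
    linarith
  have hJ' : 0 < J' := by
    by_contra! hc
    have h3 := mul_nonpos_of_nonpos_of_nonneg hc hq
    have h4 : 0 ≤ I' := by by_contra! hc'; nlinarith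
    have h5 := mul_nonpos_of_nonpos_of_nonneg hc hβ0
    nlinarith
  have hI' : 0 ≤ I' := by
    by_contra! hc
    nlinarith
  rcases le_or_gt I' I with hII | hII
  · have := hmin J' I' hJ'.le hJJ hI' hII (by linarith)
    linarith
  · rcases hJJ.eq_or_lt with rfl | hJJ
    · have c1' : I' * m₂ ≤ J' * p := by
        rcases min_le_iff.mp c1 with h | h
        · nlinarith
        · linarith
      have hαβ : α < β := by nlinarith
      have hpm := h1 hαβ
      have hIJ : I' < J' := by
        by_contra! hc
        nlinarith
      nlinarith [mul_nonneg (show 0 ≤ J' - I - 2 by lia) hβ0, mul_nonneg hI (sub_nonneg.mpr hαβ.le)]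
    · nlinarith

/-- Here `v = i v₁ + J v₂` with `ℓ(v₂) < 0`; the delicate competitor is a negative multiple of `v₂`,
which is possible only for `p = 0`. -/
lemma exists_isIrred_of_isMinComb_of_neg (hm₁ : 0 < m₁) (hm : m₁ < m₂) (hp : 0 ≤ p)
    (hq : 0 ≤ q) (ha : 0 < a) (hβ : p + q - a < 0) (h1 : m₂ - m₁ < -(p + q - a) → q < m₁)
    (h2 : p = 0 → m₁ < q) {d : ℤ} (hd : IsMinComb (m₂ - m₁) (-(p + q - a)) d) :
    ∃ i j, planeLen m₁ m₂ p q a i j = d ∧ IsIrred m₁ m₂ p q a i j := by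
  have hle := hd.le (by lia) (by lia)
  obtain ⟨hd0, i, J, hi, hJ, e, hmin⟩ := hd
  have eL : planeLen m₁ m₂ p q a i J = d := by unfold planeLen; rw [← e]; ring
  refine ⟨i, J, eL, ?_⟩
  intro i' J' c1 c2 c3 hpos
  rw [eL]
  by_contra! hlt
  unfold planeLen at hpos hlt
  have hα0 : 0 < m₂ - m₁ := by lia
  obtain ⟨δ, hδ', hδ0⟩ : ∃ δ, p + q - a = -δ ∧ 0 < δ := ⟨-(p + q - a), by ring, by lia⟩
  simp only [hδ', neg_neg] at h1 hle e hmin hpos hlt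
  have hm₂ : 0 < m₂ := by lia
  generalize m₂ - m₁ = α at *
  have hJJ : J' ≤ J := by
    have : 0 ≤ J * a := by positivity
    rw [min_eq_left (by linarith)] at c3
    by_contra! hc
    nlinarith
  have c1' : 0 ≤ i' * m₂ + J' * p := by
    have : 0 ≤ J * p := by positivity
    have : 0 ≤ i * m₂ := by positivity
    rw [min_eq_right (by linarith)] at c1
    linarith
  rcases le_or_gt 0 J' with hJ' | hJ'
  · have hi' : 0 < i' := by
      by_contra! hc
      nlinarith [mul_nonneg hJ' hδ0.le]
    rcases le_or_gt i' i with hii | hii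
    · have := hmin i' J' hi'.le hii hJ' hJJ (by linarith)
      linarith
    · nlinarith [mul_nonneg (sub_nonneg.mpr hJJ) hδ0.le]
  · have hJp := mul_nonpos_of_nonpos_of_nonneg hJ'.le hp
    have hi' : 0 ≤ i' := by
      by_contra! hc
      nlinarith
    rcases hi'.eq_or_lt with rfl | hi'
    · have hp0 : p = 0 := by
        by_contra hne
        have : 0 < p := by lia
        nlinarith
      have hmq := h2 hp0
      have c2' : (J + 1) * q ≤ i * m₁ := by
        rcases min_le_iff.mp c2 with h | h
        · nlinarith
        · nlinarith
      have hiJ : J + 2 ≤ i := by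
        have : J + 1 < i := by
          by_contra! hc
          nlinarith
        lia
      have : α < δ := by
        by_contra! hc
        nlinarith [mul_nonneg hJ (sub_nonneg.mpr hc), mul_nonneg (sub_nonneg.mpr hiJ) hα0.le]
      have := h1 this
      lia
    · nlinarith

/-- Here `v = -I v₁ - J v₂`; the delicate competitor is a positive multiple of `v₁`, excluded by `q
< m₁`. -/
lemma exists_isIrred_of_isMinComb_swap_of_neg (hm₁ : 0 < m₁) (hm : m₁ < m₂) (hp : 0 ≤ p)
    (hq : 0 ≤ q) (ha : 0 < a) (hβ : p + q - a < 0) (h1 : m₂ - m₁ < -(p + q - a) → q < m₁)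
    {d : ℤ} (hd : IsMinComb (-(p + q - a)) (m₂ - m₁) d) :
    ∃ i j, planeLen m₁ m₂ p q a i j = d ∧ IsIrred m₁ m₂ p q a i j := by
  have hle := hd.le (by lia) (by lia)
  obtain ⟨hd0, J, I, hJ, hI, e, hmin⟩ := hd
  have eL : planeLen m₁ m₂ p q a (-I) (-J) = d := by unfold planeLen; rw [← e]; ring
  refine ⟨-I, -J, eL, ?_⟩
  intro i' j' c1 c2 c3 hpos
  rw [eL]
  by_contra! hlt
  obtain ⟨I', rfl⟩ : ∃ I', i' = -I' := ⟨-i', by ring⟩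
  obtain ⟨J', rfl⟩ : ∃ J', j' = -J' := ⟨-j', by ring⟩
  unfold planeLen at hpos hlt
  have hα0 : 0 < m₂ - m₁ := by lia
  obtain ⟨δ, hδ', hδ0⟩ : ∃ δ, p + q - a = -δ ∧ 0 < δ := ⟨-(p + q - a), by ring, by lia⟩
  simp only [hδ', neg_neg] at h1 hle e hmin hpos hlt
  have hm₂ : 0 < m₂ := by lia
  generalize m₂ - m₁ = α at *
  have hJ' : 0 ≤ J' := by
    have : 0 ≤ J * a := by positivity
    rw [min_eq_right (by linarith)] at c3
    by_contra! hc
    nlinarith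
  have c1' : I' * m₂ + J' * p ≤ I * m₂ + J * p := by
    have : 0 ≤ J * p := by positivity
    have : 0 ≤ I * m₂ := by positivity
    rw [min_eq_left (by linarith)] at c1
    linarith
  rcases le_or_gt 0 I' with hI' | hI'
  · rcases le_or_gt J' J with hJJ | hJJ <;> rcases le_or_gt I' I with hII | hII
    · have := hmin J' I' hJ' hJJ hI' hII (by linarith)
      linarith
    · rcases hJJ.eq_or_lt with rfl | hJJ
      · nlinarith
      · nlinarith
    · nlinarith
    · nlinarith [mul_nonneg (sub_nonneg.mpr hJJ.le) hp]
  · rcases hJ'.eq_or_lt with rfl | hJ'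
    · have hαδ : α < δ := by nlinarith
      have hqm := h1 hαδ
      have c2' : (I + 1) * m₁ ≤ J * q := by
        rcases min_le_iff.mp c2 with h | h
        · nlinarith
        · nlinarith
      have hIJ : I + 2 ≤ J := by
        have : I + 1 < J := by
          by_contra! hc
          nlinarith
        lia
      nlinarith [mul_nonneg (sub_nonneg.mpr hIJ) hδ0.le, mul_nonneg hI (sub_nonneg.mpr hαδ.le)]
    · nlinarith

/-- The conditions on `v₂ = (p, q, -a)` under which every box-minimal combination of the two
lengths is the length of an irreducible relation. -/
structure IsReduced (m₁ m₂ p q a : ℤ) : Prop where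
  lt_of_pos : m₂ - m₁ < p + q - a → p < m₂
  lt_of_neg : m₂ - m₁ < -(p + q - a) → q < m₁
  lt_left : 0 ≤ p + q - a → q = 0 → m₂ < p
  lt_right : p + q - a < 0 → p = 0 → m₁ < q

theorem isBoxComb_iff_exists_isIrred (hm₁ : 0 < m₁) (hm : m₁ < m₂) (hp : 0 ≤ p)
    (hq : 0 ≤ q) (ha : 0 < a) (hr : IsReduced m₁ m₂ p q a) (d : ℤ) :
    IsBoxComb (m₂ - m₁) |p + q - a| d ↔
      0 < d ∧ ∃ i j, planeLen m₁ m₂ p q a i j = d ∧ IsIrred m₁ m₂ p q a i j := by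
  constructor
  · intro h
    refine ⟨h.elim And.left And.left, ?_⟩
    rcases le_or_gt 0 (p + q - a) with hβ | hβ
    · rw [abs_of_nonneg hβ] at h
      rcases h with h | h
      · exact exists_isIrred_of_isMinComb_of_nonneg hm₁ hm hp hq ha hβ hr.1 (hr.3 hβ) h
      · exact exists_isIrred_of_isMinComb_swap_of_nonneg hm₁ hm hq ha hβ hr.1 h
    · rw [abs_of_neg hβ] at h
      rcases h with h | h
      · exact exists_isIrred_of_isMinComb_of_neg hm₁ hm hp hq ha hβ hr.2 (hr.4 hβ) h
      · exact exists_isIrred_of_isMinComb_swap_of_neg hm₁ hm hp hq ha hβ hr.2 h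
  · rintro ⟨hd, i, j, rfl, h⟩
    exact h.isBoxComb hm₁ hm hp hq ha hd

end

/-! ### The Delta set through the relation lattice -/

lemma sum_mul_mem_semigroup (n z : Fin 3 → ℕ) : ∑ i, z i * n i ∈ semigroup n := by
  refine sum_mem fun i _ => ?_
  rw [← smul_eq_mul]
  exact nsmul_mem (AddSubmonoid.subset_closure (Set.mem_range_self i)) _

lemma mem_semigroup_iff {n : Fin 3 → ℕ} {s : ℕ} :
    s ∈ semigroup n ↔ ∃ z : Fin 3 → ℕ, ∑ i, z i * n i = s := by
  constructor
  · intro h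
    induction h using AddSubmonoid.closure_induction with
    | mem x hx =>
      obtain ⟨i, rfl⟩ := hx
      exact ⟨Pi.single i 1, by simp [Pi.single_apply]⟩
    | zero => exact ⟨0, by simp⟩
    | add x y _ _ hx hy =>
      obtain ⟨z, rfl⟩ := hx
      obtain ⟨w, rfl⟩ := hy
      exact ⟨z + w, by simp [add_mul, Finset.sum_add_distrib]⟩
  · rintro ⟨z, rfl⟩
    exact sum_mul_mem_semigroup n z

lemma mem_relationLattice {n : Fin 3 → ℕ} {v : Fin 3 → ℤ} :
    v ∈ relationLattice n ↔ ∑ i, v i * (n i : ℤ) = 0 := Iff.rfl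

/-- The Delta set in terms of the relation lattice. -/
theorem mem_deltaSet_iff {n : Fin 3 → ℕ} {d : ℕ} :
    d ∈ deltaSet n ↔ 0 < d ∧ ∃ v ∈ relationLattice n, ell v = d ∧
      ∀ w ∈ relationLattice n, (∀ i, min (v i) 0 ≤ w i) → 0 < ell w → (d : ℤ) ≤ ell w := by
  simp only [deltaSet, Set.mem_iUnion, exists_prop, deltaSetOf, Set.mem_ofPred_eq]
  constructor
  · rintro ⟨s, -, l, ⟨z, hz, rfl⟩, l', ⟨z', hz', rfl⟩, hlt, hno, rfl⟩
    simp only [factorizations, Set.mem_ofPred_eq, Fin.sum_univ_three] at hz hz'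
    simp only [Fin.sum_univ_three] at hlt hno ⊢
    -- The relation is `z' - z`. Its negative part is at most `z`, so adding a competitor to `z`
    -- gives a factorization again.
    refine ⟨by lia, fun i => (z' i : ℤ) - z i, ?_, ?_, ?_⟩
    · rw [mem_relationLattice, Fin.sum_univ_three]
      zify at hz hz'
      linarith
    · simp only [ell, Fin.sum_univ_three]
      lia
    · intro w hw hmin hpos
      rw [mem_relationLattice, Fin.sum_univ_three] at hw
      simp only [ell, Fin.sum_univ_three] at hpos ⊢
      have h0 := hmin 0
      have h1 := hmin 1
      have h2 := hmin 2
      simp only at h0 h1 h2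
      by_contra hc
      refine hno ((z 0 + w 0).toNat + (z 1 + w 1).toNat + (z 2 + w 2).toNat)
        ⟨fun i => (z i + w i).toNat, ?_, by simp only [Fin.sum_univ_three]⟩ (by lia)
      simp only [factorizations, Set.mem_ofPred_eq, Fin.sum_univ_three]
      zify
      rw [Int.toNat_of_nonneg (by lia), Int.toNat_of_nonneg (by lia), Int.toNat_of_nonneg (by lia)]
      zify at hz
      linarith
  · rintro ⟨hd, v, hv, he, hmin⟩
    have hvn : ∀ i, ((v i).toNat : ℤ) = (-v i).toNat + v i := fun i => by lia
    have hfac : ∑ i, (v i).toNat * n i = ∑ i, (-v i).toNat * n i := by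
      zify
      simp only [hvn, add_mul, Finset.sum_add_distrib, mem_relationLattice.mp hv, add_zero]
    have hlen : ((∑ i, (v i).toNat : ℕ) : ℤ) = (∑ i, (-v i).toNat : ℕ) + d := by
      rw [← he, ell]
      push_cast
      simp only [hvn, Finset.sum_add_distrib]
    -- The element of `S` is the common value of the factorizations `v⁻` and `v⁺`.
    refine ⟨∑ i, (-v i).toNat * n i, sum_mul_mem_semigroup n _, _, ⟨_, rfl, rfl⟩, _,
      ⟨_, hfac, rfl⟩, ?_, ?_, ?_⟩
    · simp only; lia
    · rintro k ⟨y, hy, rfl⟩ ⟨hk1, hk2⟩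
      simp only at hk1 hk2
      have hL : ell (fun i => (y i : ℤ) - (-v i).toNat) =
          ((∑ i, y i : ℕ) : ℤ) - (∑ i, (-v i).toNat : ℕ) := by
        simp only [ell, Finset.sum_sub_distrib, Nat.cast_sum]
      have := hmin (fun i => (y i : ℤ) - (-v i).toNat) ?_ (fun i => by lia)
      · rw [hL] at this
        lia
      · rw [mem_relationLattice]
        simp only [sub_mul, Finset.sum_sub_distrib]
        have hy' : ∑ i, y i * n i = ∑ i, (-v i).toNat * n i := hy
        zify at hy'
        linarith
    · simp only; lia

lemma lengths_comp_perm (n : Fin 3 → ℕ) (π : Equiv.Perm (Fin 3)) (s : ℕ) :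
    lengths (n ∘ π) s = lengths n s := by
  ext l
  constructor
  · rintro ⟨z, hz, rfl⟩
    refine ⟨z ∘ π.symm, ?_, Equiv.sum_comp π.symm z⟩
    rw [← (show ∑ i, z i * (n ∘ π) i = s from hz)]
    change ∑ i, _ = _
    rw [← Equiv.sum_comp π]
    simp
  · rintro ⟨z, hz, rfl⟩
    refine ⟨z ∘ π, ?_, Equiv.sum_comp π z⟩
    rw [← (show ∑ i, z i * n i = s from hz)]
    exact Equiv.sum_comp π fun i => z i * n i

lemma semigroup_comp_perm (n : Fin 3 → ℕ) (π : Equiv.Perm (Fin 3)) :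
    semigroup (n ∘ π) = semigroup n := by
  simp only [semigroup, EquivLike.range_comp]

lemma deltaSet_comp_perm (n : Fin 3 → ℕ) (π : Equiv.Perm (Fin 3)) :
    deltaSet (n ∘ π) = deltaSet n := by
  simp only [deltaSet, deltaSetOf, lengths_comp_perm, semigroup_comp_perm]

section
variable {n : Fin 3 → ℕ} {m₁ m₂ p q a : ℤ}

/-- The Delta set from a reduced basis of the relation lattice. -/
theorem deltaSet_eq_Euc (hm₁ : 0 < m₁) (hm : m₁ < m₂) (hp : 0 ≤ p) (hq : 0 ≤ q) (ha : 0 < a)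
    (hr : IsReduced m₁ m₂ p q a)
    (hM : ∀ v, v ∈ relationLattice n ↔
      ∃ i j : ℤ, v = i • ![m₂, -m₁, 0] + j • ![p, q, -a]) :
    deltaSet n = Euc (m₂ - m₁).toNat (p + q - a).natAbs \ {0} := by
  ext d
  rw [mem_Euc_diff_zero_iff (by lia), mem_deltaSet_iff, Int.toNat_of_nonneg (by lia),
    Int.natCast_natAbs, isBoxComb_iff_exists_isIrred hm₁ hm hp hq ha hr]
  have hell : ∀ i j : ℤ, ell (i • ![m₂, -m₁, 0] + j • ![p, q, -a]) = planeLen m₁ m₂ p q a i j := by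
    intro i j
    simp [ell, planeLen, Fin.sum_univ_three]
    ring
  have hc0 : ∀ i j : ℤ, (i • ![m₂, -m₁, 0] + j • ![p, q, -a]) 0 = i * m₂ + j * p := by simp
  have hc1 : ∀ i j : ℤ, (i • ![m₂, -m₁, 0] + j • ![p, q, -a]) 1 = -(i * m₁) + j * q := by simp
  have hc2 : ∀ i j : ℤ, (i • ![m₂, -m₁, 0] + j • ![p, q, -a]) 2 = -(j * a) := by simp
  simp only [hM, Nat.cast_pos]
  refine and_congr_right fun _ => ?_
  constructor
  · rintro ⟨_, ⟨i, j, rfl⟩, he, h⟩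
    rw [hell] at he
    refine ⟨i, j, he, ?_⟩
    intro i' j' h0 h1 h2 hpos
    have := h _ ⟨i', j', rfl⟩ ?_
    · rw [hell] at this
      rw [he]
      exact this hpos
    · rw [← hc0, ← hc0] at h0
      rw [← hc1, ← hc1] at h1
      rw [← hc2 i, ← hc2 i'] at h2
      intro k
      fin_cases k
      exacts [h0, h1, h2]
  · rintro ⟨i, j, he, h⟩
    refine ⟨_, ⟨i, j, rfl⟩, by rw [hell, he], ?_⟩
    rintro _ ⟨i', j', rfl⟩ hmin hpos
    rw [hell] at hpos ⊢
    rw [← he]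
    have h0 := hmin 0
    have h1 := hmin 1
    have h2 := hmin 2
    rw [hc0, hc0] at h0
    rw [hc1, hc1] at h1
    rw [hc2, hc2] at h2
    exact h i' j' h0 h1 h2 hpos

end

/-! ### The chosen vectors form a reduced basis -/

/-- A gluing decomposition gives a basis of the relation lattice. -/
lemma mem_relationLattice_iff_of_gluing {n : Fin 3 → ℕ} {a m₁ m₂ : ℕ} {p q : ℤ} (ha : 0 < a)
    (hm₁ : 0 < m₁) (h0 : n 0 = a * m₁) (h1 : n 1 = a * m₂) (h2 : (n 2 : ℤ) = p * m₁ + q * m₂)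
    (hm : m₁.Coprime m₂) (han : a.Coprime (n 2)) (v : Fin 3 → ℤ) :
    v ∈ relationLattice n ↔
      ∃ i j : ℤ, v = i • ![(m₂ : ℤ), -(m₁ : ℤ), 0] + j • ![p, q, -(a : ℤ)] := by
  have ha' : (a : ℤ) ≠ 0 := by exact_mod_cast ha.ne'
  have hm₁' : (m₁ : ℤ) ≠ 0 := by exact_mod_cast hm₁.ne'
  rw [mem_relationLattice, Fin.sum_univ_three, h0, h1]
  push_cast
  constructor
  · intro h
    have hdvd : (a : ℤ) ∣ v 2 := by
      refine (Nat.isCoprime_iff_coprime.mpr han).dvd_of_dvd_mul_right ⟨-(v 0 * m₁ + v 1 * m₂), ?_⟩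
      linarith
    obtain ⟨t, ht⟩ := hdvd
    rw [ht, h2] at h
    have h' : (v 0 + t * p) * m₁ + (v 1 + t * q) * m₂ = 0 := by
      apply mul_left_cancel₀ ha'
      linarith
    have hdvd : (m₁ : ℤ) ∣ v 1 + t * q := by
      refine (Nat.isCoprime_iff_coprime.mpr hm).dvd_of_dvd_mul_right ⟨-(v 0 + t * p), ?_⟩
      linarith
    obtain ⟨u, hu⟩ := hdvd
    rw [hu] at h'
    have h'' : v 0 + t * p = -u * m₂ := by
      apply mul_left_cancel₀ hm₁'
      linarith
    refine ⟨-u, -t, ?_⟩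
    ext i
    fin_cases i
    · simp; linarith
    · simp; linarith
    · simp [ht]; ring
  · rintro ⟨i, j, rfl⟩
    simp [h2]
    ring

lemma linearIndependent_gluing {a m₁ m₂ : ℤ} {p q : ℤ} (ha : a ≠ 0) (hm₁ : m₁ ≠ 0) :
    LinearIndependent ℤ ![![m₂, -m₁, 0], ![p, q, -a]] := by
  rw [LinearIndependent.pair_iff]
  intro s t h
  have e1 := congrFun h 1
  have e2 := congrFun h 2
  simp [ha] at e1 e2
  subst e2
  simpa [hm₁] using e1

lemma span_eq_relationLattice {n : Fin 3 → ℕ} {v₁ v₂ : Fin 3 → ℤ}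
    (hM : ∀ v, v ∈ relationLattice n ↔ ∃ i j : ℤ, v = i • v₁ + j • v₂) :
    Submodule.span ℤ {v₁, v₂} = relationLattice n := by
  ext v
  rw [hM, Submodule.mem_span_pair]
  simp only [eq_comm]

/-- The conclusion about chosen vectors `v₁, v₂` for the generators `n`. -/
def IsEucBasis (n : Fin 3 → ℕ) (v₁ v₂ : Fin 3 → ℤ) : Prop :=
  LinearIndependent ℤ ![v₁, v₂] ∧ Submodule.span ℤ {v₁, v₂} = relationLattice n ∧
    0 < ell v₁ ∧ deltaSet n = Euc (ell v₁).toNat (ell v₂).natAbs \ {0}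

lemma isEucBasis_of_isReduced {n : Fin 3 → ℕ} {a m₁ m₂ : ℕ} {p q : ℤ} (ha : 0 < a)
    (hm₁ : 0 < m₁) (hlt : m₁ < m₂) (hp : 0 ≤ p) (hq : 0 ≤ q)
    (h0 : n 0 = a * m₁) (h1 : n 1 = a * m₂) (h2 : (n 2 : ℤ) = p * m₁ + q * m₂)
    (hm : m₁.Coprime m₂) (han : a.Coprime (n 2)) (hr : IsReduced m₁ m₂ p q a) :
    IsEucBasis n ![(m₂ : ℤ), -(m₁ : ℤ), 0] ![p, q, -(a : ℤ)] := by
  have hM := mem_relationLattice_iff_of_gluing ha hm₁ h0 h1 h2 hm han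
  have e1 : ell ![(m₂ : ℤ), -(m₁ : ℤ), 0] = m₂ - m₁ := by
    simp [ell, Fin.sum_univ_three, sub_eq_add_neg]
  have e2 : ell ![p, q, -(a : ℤ)] = p + q - a := by
    simp [ell, Fin.sum_univ_three, sub_eq_add_neg]
  refine ⟨linearIndependent_gluing (by lia) (by lia), span_eq_relationLattice hM, by lia, ?_⟩
  rw [e1, e2]
  exact deltaSet_eq_Euc (by lia) (by lia) hp hq (by lia) hr hM

/-- This is the gluing with `a = s₃`, `m₁ = s₂`, `m₂ = s₁`, `p = 0`, `q = s₂`. As `ℓ(v₂) = s₂ - s₃ >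
0` and `q ≠ 0`, reducedness only asks for `0 < s₁`. -/
lemma IsSingleBettiBasis.isEucBasis {n : Fin 3 → ℕ} {v₁ v₂ : Fin 3 → ℤ}
    (h : IsSingleBettiBasis n v₁ v₂) : IsEucBasis n v₁ v₂ := by
  obtain ⟨-, s₁, s₂, s₃, h3, h32, h21, c12, c13, c23, rfl, rfl, rfl⟩ := h
  refine isEucBasis_of_isReduced h3 (by lia) h21 le_rfl (by lia) (mul_comm _ _) (mul_comm _ _) ?_
    c12.symm (Nat.Coprime.mul_right c13.symm c23.symm) ⟨?_, ?_, ?_, ?_⟩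
  · simp [mul_comm]
  all_goals lia

lemma IsTwoBettiBasis.isEucBasis {n : Fin 3 → ℕ} {v₁ v₂ : Fin 3 → ℤ}
    (hpos : ∀ i, 0 < n i) (hg : ∀ t, (∀ i, t ∣ n i) → t = 1)
    (h : IsTwoBettiBasis n v₁ v₂) : IsEucBasis n v₁ v₂ := by
  obtain ⟨-, a, b, c, m₁, m₂, ha, hbc, hlt, rfl, hZ, rfl, k, hk, hmin, rfl⟩ := h
  have hm₁ : 0 < m₁ := Nat.pos_of_ne_zero fun h => by
    have := hpos 0
    simp [h] at this
  have hell : ∀ k, ell (shiftVec a b c m₁ m₂ k) = b + k * m₂ + (c - k * m₁) - a := by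
    intro k
    simp [ell, shiftVec, Fin.sum_univ_three, sub_eq_add_neg]
  have hmem : ∀ k : ℤ, k ∈ Set.Icc (-((b / m₂ : ℕ) : ℤ)) ((c / m₁ : ℕ) : ℤ) ↔
      0 ≤ b + k * m₂ ∧ 0 ≤ c - k * m₁ := by
    intro k
    rw [Set.mem_Icc, neg_le, Int.natCast_div, Int.natCast_div,
      Int.le_ediv_iff_mul_le (by lia), Int.le_ediv_iff_mul_le (by lia)]
    constructor <;> rintro ⟨h1, h2⟩ <;> constructor <;> lia
  simp only [hmem, hell] at hk hmin
  have hd : ∀ t, t ∣ a * m₁ → t ∣ a * m₂ → t ∣ b * m₁ + c * m₂ → t = 1 := by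
    intro t t0 t1 t2
    refine hg t fun i => ?_
    fin_cases i
    exacts [t0, t1, t2]
  have hn2 : ((b * m₁ + c * m₂ : ℕ) : ℤ) = (b + k * m₂) * m₁ + (c - k * m₁) * m₂ := by
    push_cast; ring
  -- Such an equation would give `a m₁ m₂` a third factorization, `(x, y, a)`.
  have hZ' : ∀ x y : ℕ, x * m₁ + y * m₂ + (b * m₁ + c * m₂) ≠ m₁ * m₂ := by
    intro x y he
    have : ![x, y, a] ∈ factorizations ![a * m₁, a * m₂, b * m₁ + c * m₂] (a * m₁ * m₂) := by
      change ∑ i, _ = _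
      simp only [Fin.sum_univ_three, Matrix.cons_val]
      rw [mul_assoc, ← he]
      ring
    rw [hZ] at this
    rcases this with h | h <;> have := congrFun h 2 <;> simp at this <;> lia
  refine isEucBasis_of_isReduced (by lia) hm₁ hlt hk.1 hk.2 rfl rfl hn2 ?_ ?_ ⟨?_, ?_, ?_, ?_⟩
  · refine hd _ ?_ ?_ ?_
    · exact (Nat.gcd_dvd_left _ _).mul_left _
    · exact (Nat.gcd_dvd_right _ _).mul_left _
    · exact dvd_add ((Nat.gcd_dvd_left _ _).mul_left _) ((Nat.gcd_dvd_right _ _).mul_left _)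
  · refine hd _ ?_ ?_ ?_
    · exact (Nat.gcd_dvd_left _ _).mul_right _
    · exact (Nat.gcd_dvd_left _ _).mul_right _
    · exact Nat.gcd_dvd_right _ _
  -- If `p ≥ m₂`, then subtracting `v₁` from `v₂` is an admissible shift and shortens it; the next
  -- goal uses adding `v₁` in the same way.
  · intro h
    by_contra! hc
    have h1 : (k - 1) * (m₂ : ℤ) = k * m₂ - m₂ := by ring
    have h2 : (k - 1) * (m₁ : ℤ) = k * m₁ - m₁ := by ring
    have := hmin (k - 1) ⟨by lia, by lia⟩
    rw [h1, h2, abs_of_pos (by lia), abs_of_pos (by lia)] at this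
    lia
  · intro h
    by_contra! hc
    have h1 : (k + 1) * (m₂ : ℤ) = k * m₂ + m₂ := by ring
    have h2 : (k + 1) * (m₁ : ℤ) = k * m₁ + m₁ := by ring
    have := hmin (k + 1) ⟨by lia, by lia⟩
    rw [h1, h2, abs_of_neg (by lia), abs_of_neg (by lia)] at this
    lia
  -- With `q = 0` and `p ≤ m₂`, the third generator is `p m₁`, and `(m₂ - p) m₁ + p m₁ = m₁ m₂` is
  -- forbidden by `hZ'`.
  · intro _ h
    by_contra! hc
    apply hZ' (m₂ - (b + k * m₂)).toNat 0
    zify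
    rw [Int.toNat_of_nonneg (by lia)]
    push_cast at hn2
    rw [hn2, h]
    ring
  · intro _ h
    by_contra! hc
    apply hZ' 0 (m₁ - (c - k * m₁)).toNat
    zify
    rw [Int.toNat_of_nonneg (by lia)]
    push_cast at hn2
    rw [hn2, h]
    ring

/-- A shift of minimal length exists. -/
lemma exists_minimal_shift (a b c m₁ m₂ : ℕ) :
    ∃ k ∈ Set.Icc (-((b / m₂ : ℕ) : ℤ)) ((c / m₁ : ℕ) : ℤ),
      ∀ k' ∈ Set.Icc (-((b / m₂ : ℕ) : ℤ)) ((c / m₁ : ℕ) : ℤ),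
        |ell (shiftVec a b c m₁ m₂ k)| ≤ |ell (shiftVec a b c m₁ m₂ k')| :=
  Set.exists_min_image _ _ (Set.finite_Icc _ _) ⟨0, by lia, by lia⟩

/-! ### Betti elements of a gluing -/

section
variable {n : Fin 3 → ℕ}

lemma mem_factorizations {z : Fin 3 → ℕ} {s : ℕ} :
    z ∈ factorizations n s ↔ z 0 * n 0 + z 1 * n 1 + z 2 * n 2 = s := by
  rw [← Fin.sum_univ_three (fun i => z i * n i)]
  rfl

lemma factGraph_reachable_of_common {s : ℕ} {z w : factorizations n s}
    (h : ∃ i, z.1 i ≠ 0 ∧ w.1 i ≠ 0) : (factGraph n s).Reachable z w := by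
  by_cases e : z = w
  · rw [e]
  · exact SimpleGraph.Adj.reachable ⟨e, h⟩

/-- A factorization that shares no coordinate with another one isolates the graph. -/
lemma not_connected_of_isolated {s : ℕ} {z w : factorizations n s} (hne : z ≠ w)
    (h : ∀ y : factorizations n s, (∃ i, z.1 i ≠ 0 ∧ y.1 i ≠ 0) → y = z) :
    ¬ (factGraph n s).Connected := by
  intro hc
  obtain ⟨p⟩ := hc.preconnected z w
  cases p with
  | nil => exact hne rfl
  | cons hadj _ => exact hadj.1 (h _ hadj.2).symm

variable {a b c m₁ m₂ : ℕ}

/-- Coprimality makes `a` divide the third coordinate of every factorization, so `(0, 0, a)` is the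
only one using the third generator, while `(b, c, 0)` avoids it. -/
lemma mul_last_mem_betti (ha : 0 < a) (hn : n = ![a * m₁, a * m₂, b * m₁ + c * m₂])
    (hpos : ∀ i, 0 < n i) (han : a.Coprime (b * m₁ + c * m₂)) :
    a * (b * m₁ + c * m₂) ∈ betti n := by
  have h0 : n 0 = a * m₁ := by rw [hn]; rfl
  have h1 : n 1 = a * m₂ := by rw [hn]; rfl
  have h2 : n 2 = b * m₁ + c * m₂ := by rw [hn]; rfl
  rw [← h2] at han ⊢
  have hz : ![0, 0, a] ∈ factorizations n (a * n 2) := by simp [mem_factorizations]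
  have hw : ![b, c, 0] ∈ factorizations n (a * n 2) := by
    rw [mem_factorizations, h0, h1, h2]
    simp
    ring
  refine ⟨mem_semigroup_iff.mpr ⟨_, hz⟩,
    not_connected_of_isolated (z := ⟨_, hz⟩) (w := ⟨_, hw⟩) ?_ ?_⟩
  · intro h
    have := congrFun (congrArg Subtype.val h) 2
    simp at this
    lia
  · rintro ⟨y, hy⟩ ⟨i, hi, hi'⟩
    simp only at hi hi'
    obtain rfl : i = 2 := by fin_cases i <;> simp_all
    rw [mem_factorizations] at hy
    have hdvd : a ∣ y 2 := by
      refine han.dvd_of_dvd_mul_right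
        ((Nat.dvd_add_right (b := y 0 * n 0 + y 1 * n 1) ?_).mp ?_)
      · rw [h0, h1]
        exact ⟨y 0 * m₁ + y 1 * m₂, by ring⟩
      · rw [hy]
        exact dvd_mul_right _ _
    have hle : a ≤ y 2 := Nat.le_of_dvd (by lia) hdvd
    have h4 : a * n 2 ≤ y 2 * n 2 := Nat.mul_le_mul_right _ hle
    have e0 : y 0 * n 0 = 0 := by lia
    have e1 : y 1 * n 1 = 0 := by lia
    have e2 : y 2 * n 2 = a * n 2 := by lia
    ext i
    fin_cases i
    · simpa [(hpos 0).ne'] using e0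
    · simpa [(hpos 1).ne'] using e1
    · simpa [(hpos 2).ne'] using e2

/-- Any factorization is connected to any other by trading `(m₂, 0, 0)` for `(0, m₁, 0)` and `(0, 0,
a)` for `(b, c, 0)`. A trade joins two factorizations with a common coordinate unless it consumes
the whole factorization, which happens only at the two listed elements. -/
lemma betti_subset_of_gluing (ha : 0 < a) (hn : n = ![a * m₁, a * m₂, b * m₁ + c * m₂])
    (hpos : ∀ i, 0 < n i) (hm : m₁.Coprime m₂) (han : a.Coprime (b * m₁ + c * m₂)) :
    betti n ⊆ {a * m₁ * m₂, a * (b * m₁ + c * m₂)} := by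
  have h0 : n 0 = a * m₁ := by rw [hn]; rfl
  have h1 : n 1 = a * m₂ := by rw [hn]; rfl
  have h2 : n 2 = b * m₁ + c * m₂ := by rw [hn]; rfl
  have hm₁ : 0 < m₁ := Nat.pos_of_mul_pos_left (h0 ▸ hpos 0)
  have hm₂ : 0 < m₂ := Nat.pos_of_mul_pos_left (h1 ▸ hpos 1)
  rintro s ⟨hs, hconn⟩
  by_contra hcon
  simp only [Set.mem_insert_iff, Set.mem_singleton_iff, not_or] at hcon
  obtain ⟨hs1, hs2⟩ := hcon
  obtain ⟨z₀, hz₀⟩ := mem_semigroup_iff.mp hs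
  have : Nonempty (factorizations n s) := ⟨⟨z₀, hz₀⟩⟩
  refine hconn ⟨?_⟩
  -- If all factorizations use the third generator, they are pairwise adjacent; otherwise `a`
  -- divides `s`.
  by_cases hall : ∀ z : factorizations n s, z.1 2 ≠ 0
  · exact fun z w => factGraph_reachable_of_common ⟨2, hall z, hall w⟩
  push Not at hall
  obtain ⟨z', hz'⟩ := hall
  have hbase : ∀ N : ℕ, ∀ z w : factorizations n s, z.1 2 = 0 → w.1 2 = 0 → w.1 0 ≤ z.1 0 →
      z.1 0 - w.1 0 ≤ N → (factGraph n s).Reachable z w := by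
    intro N
    induction N using Nat.strong_induction_on with
    | _ N ih =>
      intro z w hz hw hle hN
      have ez := mem_factorizations.mp z.2
      have ew := mem_factorizations.mp w.2
      rw [h0, h1, hz, zero_mul, add_zero] at ez
      rw [h0, h1, hw, zero_mul, add_zero] at ew
      have e : z.1 0 * m₁ + z.1 1 * m₂ = w.1 0 * m₁ + w.1 1 * m₂ := by
        apply Nat.eq_of_mul_eq_mul_left ha
        lia
      rcases hle.eq_or_lt with heq | hlt
      · have : z = w := by
          ext i
          fin_cases i
          · exact heq.symm
          · change z.1 1 = w.1 1
            apply Nat.eq_of_mul_eq_mul_right hm₂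
            rw [heq] at e
            lia
          · exact hz.trans hw.symm
        rw [this]
      · obtain ⟨t, ht⟩ : ∃ t, z.1 0 = w.1 0 + t := ⟨z.1 0 - w.1 0, by lia⟩
        rw [ht] at e
        have hdvd : m₂ ∣ t := by
          refine hm.symm.dvd_of_dvd_mul_right
            ((Nat.dvd_add_right (b := z.1 1 * m₂) (dvd_mul_left _ _)).mp ⟨w.1 1, ?_⟩)
          lia
        have hmt : m₂ ≤ t := Nat.le_of_dvd (by lia) hdvd
        obtain ⟨u, hu⟩ : ∃ u, z.1 0 = u + m₂ := ⟨z.1 0 - m₂, by lia⟩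
        have hy : ![u, z.1 1 + m₁, 0] ∈ factorizations n s := by
          rw [mem_factorizations, h0, h1]
          rw [hu] at ez
          refine Eq.trans ?_ ez
          simp
          ring
        have hyw : (factGraph n s).Reachable ⟨_, hy⟩ w :=
          ih (t - m₂) (by lia) ⟨_, hy⟩ w rfl hw (by simp; lia) (by simp; lia)
        refine (factGraph_reachable_of_common ?_).trans hyw
        by_cases hz1 : z.1 1 = 0
        · refine ⟨0, by lia, ?_⟩
          rintro (hu0 : u = 0)
          apply hs1
          rw [← ez, hz1, hu, hu0]
          ring
        · exact ⟨1, hz1, by simp; lia⟩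
  have hlayer : ∀ N : ℕ, ∀ z : factorizations n s, z.1 2 = N →
      ∃ w : factorizations n s, w.1 2 = 0 ∧ (factGraph n s).Reachable z w := by
    intro N
    induction N using Nat.strong_induction_on with
    | _ N ih =>
      intro z hz
      rcases Nat.eq_zero_or_pos N with rfl | hN
      · exact ⟨z, hz, .rfl⟩
      have ez := mem_factorizations.mp z.2
      have ez' := mem_factorizations.mp z'.2
      rw [h0, h1] at ez
      rw [h0, h1, hz', zero_mul, add_zero] at ez'
      have hdvd : a ∣ z.1 2 := by
        refine (h2 ▸ han : a.Coprime (n 2)).dvd_of_dvd_mul_right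
          ((Nat.dvd_add_right (b := z.1 0 * (a * m₁) + z.1 1 * (a * m₂)) ?_).mp ?_)
        · exact ⟨z.1 0 * m₁ + z.1 1 * m₂, by ring⟩
        · rw [ez, ← ez']
          exact ⟨z'.1 0 * m₁ + z'.1 1 * m₂, by ring⟩
      have hle : a ≤ z.1 2 := Nat.le_of_dvd (by lia) hdvd
      obtain ⟨u, hu⟩ : ∃ u, z.1 2 = u + a := ⟨z.1 2 - a, by lia⟩
      have hy : ![z.1 0 + b, z.1 1 + c, u] ∈ factorizations n s := by
        rw [mem_factorizations, h0, h1]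
        rw [hu] at ez
        refine Eq.trans ?_ ez
        simp [h2]
        ring
      obtain ⟨w, hw, hyw⟩ := ih u (by lia) ⟨_, hy⟩ rfl
      refine ⟨w, hw, (factGraph_reachable_of_common ?_).trans hyw⟩
      by_cases hu0 : u = 0
      · by_cases hz0 : z.1 0 = 0
        · refine ⟨1, ?_⟩
          have : z.1 1 ≠ 0 := by
            intro hz1
            apply hs2
            rw [← ez, hz0, hz1, hu, hu0, h2]
            ring
          exact ⟨this, by simp; lia⟩
        · exact ⟨0, hz0, by simp; lia⟩
      · exact ⟨2, by lia, hu0⟩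
  intro z w
  obtain ⟨z₁, hz₁, hzr⟩ := hlayer _ z rfl
  obtain ⟨w₁, hw₁, hwr⟩ := hlayer _ w rfl
  refine hzr.trans (SimpleGraph.Reachable.trans ?_ hwr.symm)
  rcases le_total (w₁.1 0) (z₁.1 0) with h | h
  · exact hbase _ z₁ w₁ hz₁ hw₁ h le_rfl
  · exact (hbase _ w₁ z₁ hw₁ hz₁ h le_rfl).symm

end

/-! ### Symmetric semigroups with three generators are gluings -/

/-- `c` is the least positive integer with `c x ∈ ⟨y, z⟩`. -/
def IsCrit (x y z c : ℕ) : Prop :=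
  (0 < c ∧ ∃ u v, c * x = u * y + v * z) ∧ ∀ c' u v, 0 < c' → c' * x = u * y + v * z → c ≤ c'

lemma exists_isCrit (x y z : ℕ) (hy : 0 < y) : ∃ c, IsCrit x y z c := by
  classical
  have h : ∃ c, 0 < c ∧ ∃ u v, c * x = u * y + v * z := ⟨y, hy, x, 0, by ring⟩
  exact ⟨Nat.find h, Nat.find_spec h, fun c' u v h0 h1 => Nat.find_min' h ⟨h0, u, v, h1⟩⟩

lemma IsCrit.symm {x y z c : ℕ} (h : IsCrit x y z c) : IsCrit x z y c := by
  obtain ⟨⟨h0, u, v, e⟩, h1⟩ := h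
  exact ⟨⟨h0, v, u, by rw [e, add_comm]⟩, fun c' u v h0 e => h1 c' v u h0 (by rw [e, add_comm])⟩

/-- If every element of the Apéry set of `x` lies below `W`, then a critical multiple of `y` that
is not a multiple of `z` gives a factorization of `W` with `y`-coefficient `c - 1`. -/
lemma IsCrit.exists_top_eq {x y z c W : ℕ} (hx : 0 < x) (hc : IsCrit y x z c)
    (hW1 : ∀ α β γ, W ≠ (α + 1) * x + β * y + γ * z)
    (hW2 : ∀ w, (∀ α β γ, w ≠ (α + 1) * x + β * y + γ * z) →
      ∃ α β γ, w + (α * x + β * y + γ * z) = W)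
    (hne : ∀ r, c * y ≠ r * z) :
    (∃ γ, W = (c - 1) * y + γ * z) ∧ ∀ β γ, W = β * y + γ * z → β < c := by
  obtain ⟨⟨h0, u, v, e⟩, hmin⟩ := hc
  have hu : 0 < u := Nat.pos_of_ne_zero (by rintro rfl; exact hne v (by lia))
  have hlt : ∀ β γ, W = β * y + γ * z → β < c := by
    intro β γ hW
    by_contra! hcβ
    obtain ⟨t, rfl⟩ := Nat.exists_eq_add_of_le hcβ
    obtain ⟨u', rfl⟩ : ∃ u', u = u' + 1 := ⟨u - 1, by lia⟩
    apply hW1 u' t (v + γ)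
    rw [hW, add_mul, e]
    ring
  refine ⟨?_, hlt⟩
  obtain ⟨c', rfl⟩ : ∃ c', c = c' + 1 := ⟨c - 1, by lia⟩
  -- By minimality of `c`, the multiple `(c - 1) y` lies in the Apéry set of `x`, hence is a summand
  -- of `W`.
  obtain ⟨α, β, γ, hW⟩ := hW2 (c' * y) (by
    intro α β γ h
    have hpos : 0 < (α + 1) * x := by positivity
    have hβ : β < c' := by
      by_contra! hcb
      have := Nat.mul_le_mul_right y hcb
      lia
    obtain ⟨t, rfl⟩ := Nat.exists_eq_add_of_lt hβ
    have := hmin (t + 1) (α + 1) γ (by lia) (by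
      have : (β + t + 1) * y = β * y + (t + 1) * y := by ring
      lia)
    lia)
  obtain rfl : α = 0 := by
    by_contra hα
    obtain ⟨α', rfl⟩ : ∃ α', α = α' + 1 := ⟨α - 1, by lia⟩
    apply hW1 α' (c' + β) γ
    rw [← hW]
    ring
  have hW' : W = (c' + β) * y + γ * z := by rw [← hW]; ring
  obtain rfl : β = 0 := by have := hlt _ _ hW'; lia
  exact ⟨γ, by simpa using hW'⟩

/-- If `u ≥ c₂`, substituting the relation for `c₂ y`, which involves `x`, lets copies of `x`
cancel. This yields a smaller critical multiple of `x`, or else shows that `c₁ x` is a multiple of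
`y`. -/
lemma IsCrit.lt_of_eq {x y z c₁ c₂ u v : ℕ} (hx : 0 < x) (h₁ : IsCrit x y z c₁)
    (h₂ : IsCrit y x z c₂) (e : c₁ * x = u * y + v * z) (hne : ∀ r, c₂ * y ≠ r * z)
    (hne' : ∀ r, c₁ * x ≠ r * y) : u < c₂ := by
  by_contra! hc
  obtain ⟨t, rfl⟩ := Nat.exists_eq_add_of_le hc
  obtain ⟨⟨h0, u', v', e'⟩, -⟩ := h₂
  have e2 : c₁ * x = t * y + u' * x + (v + v') * z := by
    rw [e, add_mul, e']; ring
  have hu' : 0 < u' := Nat.pos_of_ne_zero (by rintro rfl; exact hne v' (by lia))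
  have hle : u' ≤ c₁ := by
    by_contra! hcu
    have := Nat.mul_lt_mul_of_pos_right hcu hx
    lia
  rcases hle.eq_or_lt with rfl | hlt
  · have : v * z + v' * z = 0 := by rw [← add_mul]; lia
    exact hne' (c₂ + t) (by lia)
  · obtain ⟨s, rfl⟩ := Nat.exists_eq_add_of_lt hlt
    have := h₁.2 (s + 1) t (v + v') (by lia) (by
      have : (u' + s + 1) * x = u' * x + (s + 1) * x := by ring
      lia)
    lia

/-- If the Apéry set of `x` has a largest element, then some critical multiple of one generator is
a multiple of another generator. -/
theorem exists_crit_multiple {x y z W c₁ c₂ c₃ : ℕ} (hx : 0 < x) (hz : 0 < z)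
    (h₁ : IsCrit x y z c₁) (h₂ : IsCrit y x z c₂) (h₃ : IsCrit z x y c₃)
    (hW1 : ∀ α β γ, W ≠ (α + 1) * x + β * y + γ * z)
    (hW2 : ∀ w, (∀ α β γ, w ≠ (α + 1) * x + β * y + γ * z) →
      ∃ α β γ, w + (α * x + β * y + γ * z) = W) :
    (∃ r, c₁ * x = r * y) ∨ (∃ r, c₁ * x = r * z) ∨ (∃ r, c₂ * y = r * z) ∨
      ∃ r, c₃ * z = r * y := by
  by_contra! hcon
  obtain ⟨n1, n2, n3, n4⟩ := hcon
  obtain ⟨⟨γ, hγ⟩, -⟩ := h₂.exists_top_eq hx hW1 hW2 n3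
  obtain ⟨⟨β, hβ⟩, hlt⟩ := h₃.exists_top_eq (W := W) hx
    (fun α β γ h => hW1 α γ β (by rw [h]; ring))
    (fun w hw => by
      obtain ⟨α, β, γ, h⟩ := hW2 w fun α β γ h => hw α γ β (by rw [h]; ring)
      exact ⟨α, γ, β, by rw [← h]; ring⟩) n4
  have hγc : γ < c₃ := hlt γ (c₂ - 1) (by rw [hγ]; ring)
  have hc₂ := h₂.1.1
  obtain ⟨c₂, rfl⟩ : ∃ c', c₂ = c' + 1 := ⟨c₂ - 1, by lia⟩
  obtain ⟨c₃, rfl⟩ : ∃ c', c₃ = c' + 1 := ⟨c₃ - 1, by lia⟩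
  simp only [Nat.add_sub_cancel] at hγ hβ
  -- The two expressions for `W` agree: otherwise their difference makes a positive multiple of `y`
  -- below its critical multiple equal to a multiple of `z`. So `W = (c₂ - 1) y + (c₃ - 1) z`.
  have hγ' : γ = c₃ := by
    by_contra hne
    obtain ⟨t, rfl⟩ := Nat.exists_eq_add_of_lt (show γ < c₃ by lia)
    have ht : (γ + t + 1) * z = γ * z + (t + 1) * z := by ring
    have hpos : 0 < (t + 1) * z := by positivity
    have hβc : β < c₂ := by
      by_contra! hcb
      have := Nat.mul_le_mul_right y hcb
      lia
    obtain ⟨s, rfl⟩ := Nat.exists_eq_add_of_lt hβc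
    have hs : (β + s + 1) * y = β * y + (s + 1) * y := by ring
    have := h₂.2 (s + 1) 0 (t + 1) (by lia) (by lia)
    lia
  subst hγ'
  obtain ⟨hc₁, u, v, e⟩ := h₁.1
  have hu := h₁.lt_of_eq hx h₂ e n3 n1
  have hv := h₁.symm.lt_of_eq hx h₃ (by rw [e, add_comm]) n4 n2
  obtain ⟨s, rfl⟩ := Nat.exists_eq_add_of_le (Nat.le_of_lt_succ hu)
  obtain ⟨t, rfl⟩ := Nat.exists_eq_add_of_le (Nat.le_of_lt_succ hv)
  obtain ⟨c₁, rfl⟩ : ∃ c', c₁ = c' + 1 := ⟨c₁ - 1, by lia⟩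
  -- As `c₁ x = u y + v z` with `u < c₂` and `v < c₃`, it can be taken out of `W`, although `W` is
  -- in the Apéry set of `x`.
  apply hW1 c₁ s t
  rw [hγ, e]
  ring

/-- Either `z ∈ ⟨p, q⟩` or `p q - p - q - z ∈ ⟨p, q⟩`. -/
lemma mem_or_sub_mem_of_coprime {p q : ℕ} (hq : 0 < q) (h : p.Coprime q) (z : ℕ) :
    (∃ b c, z = b * p + c * q) ∨ ∃ u w, z + (u + 1) * p + (w + 1) * q = p * q := by
  have hbez : (1 : ℤ) = p * p.gcdA q + q * p.gcdB q := by
    rw [← Nat.gcd_eq_gcd_ab, h.gcd_eq_one]; rfl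
  have hq' : (0 : ℤ) < q := by exact_mod_cast hq
  obtain ⟨A, B, hAB⟩ : ∃ A B : ℤ, (1 : ℤ) = p * A + q * B := ⟨_, _, hbez⟩
  -- The coefficient of `p` is reduced to `0 ≤ b < q`; the sign of the resulting coefficient of `q`
  -- decides between the two alternatives.
  obtain ⟨b, t, hb0, hbq, hbt⟩ : ∃ b t : ℤ, 0 ≤ b ∧ b < q ∧ z * A = b + t * q :=
    ⟨z * A % q, z * A / q, Int.emod_nonneg _ hq'.ne', Int.emod_lt_of_pos _ hq',
      by rw [mul_comm (_ / _)]; exact (Int.emod_add_mul_ediv _ _).symm⟩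
  have hz : (z : ℤ) = b * p + (t * p + z * B) * q := by
    linear_combination (z : ℤ) * hAB + p * hbt
  generalize t * p + z * B = v at hz
  obtain ⟨b, rfl⟩ := Int.eq_ofNat_of_zero_le hb0
  rcases le_or_gt 0 v with hv | hv
  · obtain ⟨v, rfl⟩ := Int.eq_ofNat_of_zero_le hv
    exact Or.inl ⟨b, v, by exact_mod_cast hz⟩
  · obtain ⟨w, hw⟩ : ∃ w : ℕ, v = -(w + 1) := ⟨(-v - 1).toNat, by lia⟩
    obtain ⟨u, hu⟩ : ∃ u : ℕ, (q : ℤ) = b + (u + 1) := ⟨q - b - 1, by lia⟩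
    refine Or.inr ⟨u, w, ?_⟩
    zify
    rw [hz, hw, hu]
    ring

/-- A critical relation between two generators only leads to a gluing. -/
lemma IsCrit.exists_gluing {x y z c r : ℕ} (hy : 0 < y) (hx : 0 < x)
    (hc : IsCrit x y z c) (e : c * x = r * y) :
    ∃ a m₁ m₂ b c, x = a * m₁ ∧ y = a * m₂ ∧ z = b * m₁ + c * m₂ ∧ m₁.Coprime m₂ := by
  obtain ⟨m₁, m₂, hm, hx', hy'⟩ := Nat.exists_coprime x y
  have hg : 0 < x.gcd y := Nat.gcd_pos_of_pos_left _ hx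
  generalize x.gcd y = g at *
  have hm₂ : 0 < m₂ := Nat.pos_of_ne_zero (by rintro rfl; simp at hy'; lia)
  have hm₁ : 0 < m₁ := Nat.pos_of_ne_zero (by rintro rfl; simp at hx'; lia)
  rcases mem_or_sub_mem_of_coprime hm₂ hm z with ⟨b, c, h⟩ | ⟨u, w, h⟩
  · exact ⟨g, m₁, m₂, b, c, by rw [hx', mul_comm], by rw [hy', mul_comm], h, hm⟩
  · exfalso
    have hdvd : m₂ ∣ c := by
      refine hm.symm.dvd_of_dvd_mul_right ⟨r, ?_⟩
      apply Nat.eq_of_mul_eq_mul_right hg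
      rw [mul_assoc, ← hx', e, hy']
      ring
    have hle := Nat.le_of_dvd hc.1.1 hdvd
    have hu : u + 1 < m₂ := by
      by_contra! hcu
      have h1 := Nat.mul_le_mul_right m₁ hcu
      have : 0 < (w + 1) * m₂ := by positivity
      rw [mul_comm m₂ m₁] at h1
      lia
    obtain ⟨t, rfl⟩ := Nat.exists_eq_add_of_lt hu
    -- Here `t + 1 = m₂ - (u + 1)` and `(t + 1) m₁ = z + (w + 1) m₂`. Multiplying by `g` puts `(t +
    -- 1) x` in `⟨y, z⟩` with `t + 1 < m₂ ≤ c`.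
    have := hc.2 (t + 1) (w + 1) g (by lia) (by
      rw [hx', hy']
      have h' : (t + 1) * m₁ = z + (w + 1) * (u + 1 + t + 1) := by
        have : m₁ * (u + 1 + t + 1) = (u + 1) * m₁ + (t + 1) * m₁ := by ring
        lia
      rw [← mul_assoc, h']
      ring)
    lia

/-- No generator is a combination of two others. -/
def IsIndecomposable (n : Fin 3 → ℕ) : Prop :=
  ∀ i j k, i ≠ j → i ≠ k → ∀ u v, n i ≠ u * n j + v * n k

lemma IsMinimalGen.isIndecomposable {n : Fin 3 → ℕ} (h : IsMinimalGen n) :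
    IsIndecomposable n := by
  intro i j k hij hik u v e
  apply h i
  rw [e, ← smul_eq_mul, ← smul_eq_mul]
  have hmem : ∀ j, i ≠ j → n j ∈ AddSubmonoid.closure (n '' {i}ᶜ) := fun j hj =>
    AddSubmonoid.subset_closure (Set.mem_image_of_mem n hj.symm)
  exact add_mem (nsmul_mem (hmem j hij) _) (nsmul_mem (hmem k hik) _)

lemma IsIndecomposable.comp_perm {n : Fin 3 → ℕ} (h : IsIndecomposable n)
    (π : Equiv.Perm (Fin 3)) : IsIndecomposable (n ∘ π) :=
  fun _ _ _ hij hik => h _ _ _ (π.injective.ne hij) (π.injective.ne hik)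

lemma IsIndecomposable.pos {n : Fin 3 → ℕ} (h : IsIndecomposable n) (i : Fin 3) : 0 < n i := by
  refine Nat.pos_of_ne_zero fun h0 => h i (i + 1) (i + 1) ?_ ?_ 0 0 (by simp [h0]) <;>
    fin_cases i <;> decide

/-- A symmetric semigroup with three generators is a gluing. -/
theorem exists_gluing_of_isSymmetric {n : Fin 3 → ℕ} (hn : IsIndecomposable n)
    (hs : IsSymmetric (semigroup n)) :
    ∃ (π : Equiv.Perm (Fin 3)) (a m₁ m₂ b c : ℕ),
      n ∘ π = ![a * m₁, a * m₂, b * m₁ + c * m₂] ∧ m₁.Coprime m₂ := by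
  obtain ⟨F, ⟨hF, hmax⟩, hsymm⟩ := hs
  have hx := hn.pos 0
  have hy := hn.pos 1
  have hz := hn.pos 2
  have hmem : ∀ x : ℤ, x ∈ intSet (semigroup n) ↔
      ∃ α β γ : ℕ, x = α * n 0 + β * n 1 + γ * n 2 := by
    intro x
    constructor
    · rintro ⟨s, hs, rfl⟩
      obtain ⟨z, rfl⟩ := mem_semigroup_iff.mp hs
      exact ⟨z 0, z 1, z 2, by simp [Fin.sum_univ_three]⟩
    · rintro ⟨α, β, γ, rfl⟩
      refine ⟨α * n 0 + β * n 1 + γ * n 2, mem_semigroup_iff.mpr ⟨![α, β, γ], ?_⟩, by simp⟩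
      simp [Fin.sum_univ_three]
  -- `W = F + n 0` is the largest element of the Apéry set of `n 0`; symmetry says that `W - w ∈ S`
  -- for every `w` in this set.
  obtain ⟨W, hW⟩ : ∃ W : ℕ, F + n 0 = W := by
    have : F + n 0 ∈ intSet (semigroup n) := by
      by_contra hc
      have := hmax hc
      lia
    obtain ⟨W, -, h⟩ := this
    exact ⟨W, h.symm⟩
  obtain ⟨c₁, h₁⟩ := exists_isCrit (n 0) (n 1) (n 2) hy
  obtain ⟨c₂, h₂⟩ := exists_isCrit (n 1) (n 0) (n 2) hx
  obtain ⟨c₃, h₃⟩ := exists_isCrit (n 2) (n 0) (n 1) hx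
  have key := exists_crit_multiple (W := W) hx hz h₁ h₂ h₃ (by
      intro α β γ h
      apply hF
      rw [hmem]
      refine ⟨α, β, γ, ?_⟩
      zify at h
      linarith) (by
      intro w hw
      have : (w : ℤ) - n 0 ∉ intSet (semigroup n) := by
        rw [hmem]
        rintro ⟨α, β, γ, h⟩
        apply hw α β γ
        zify
        linarith
      obtain ⟨α, β, γ, h⟩ := (hmem _).mp (hsymm _ this)
      refine ⟨α, β, γ, ?_⟩
      zify
      linarith)
  have finish : ∀ i j k c r, (∃ π : Equiv.Perm (Fin 3), π 0 = i ∧ π 1 = j ∧ π 2 = k) →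
      IsCrit (n i) (n j) (n k) c → c * n i = r * n j →
      ∃ (π : Equiv.Perm (Fin 3)) (a m₁ m₂ b c : ℕ),
        n ∘ π = ![a * m₁, a * m₂, b * m₁ + c * m₂] ∧ m₁.Coprime m₂ := by
    rintro i j k c r ⟨π, rfl, rfl, rfl⟩ hc e
    obtain ⟨a, m₁, m₂, b, c, e0, e1, e2, hm⟩ := hc.exists_gluing (hn.pos _) (hn.pos _) e
    refine ⟨π, a, m₁, m₂, b, c, ?_, hm⟩
    ext l
    fin_cases l
    exacts [e0, e1, e2]
  rcases key with ⟨r, e⟩ | ⟨r, e⟩ | ⟨r, e⟩ | ⟨r, e⟩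
  · exact finish 0 1 2 _ r (by decide) h₁ e
  · exact finish 0 2 1 _ r (by decide) h₁.symm e
  · exact finish 1 2 0 _ r (by decide) h₂.symm e
  · exact finish 2 1 0 _ r (by decide) h₃.symm e

/-! ### Existence of chosen vectors -/

lemma eq_of_mul_add_mul_eq_mul {p q u v : ℕ} (hp : 0 < p) (hq : 0 < q) (h : p.Coprime q)
    (e : u * p + v * q = p * q) : (u = q ∧ v = 0) ∨ (u = 0 ∧ v = p) := by
  have hdvd : q ∣ u := by
    refine h.symm.dvd_of_dvd_mul_right
      ((Nat.dvd_add_left (dvd_mul_left q v)).mp ?_)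
    rw [e]
    exact dvd_mul_left _ _
  obtain ⟨t, rfl⟩ := hdvd
  have e' : t * p + v = p := by
    apply Nat.eq_of_mul_eq_mul_right hq
    rw [← e]; ring
  rcases t with _ | _ | t
  · right; simpa using e'
  · left; simpa using e'
  · exfalso
    have : (t + 1 + 1) * p = t * p + p + p := by ring
    lia

section
variable {n : Fin 3 → ℕ} {a b c m₁ m₂ : ℕ}

/-- Coprimality forces the third generator to occur in blocks of `a`. One such block would give a
representation excluded by `hno`, and without one only the two factorizations of `m₁ m₂` remain. -/
lemma factorizations_eq_pair (ha : 0 < a) (hm₁ : 0 < m₁) (hm₂ : 0 < m₂)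
    (hn : n = ![a * m₁, a * m₂, b * m₁ + c * m₂])
    (hm : m₁.Coprime m₂) (han : a.Coprime (b * m₁ + c * m₂))
    (hno : ∀ x y, x * m₁ + y * m₂ + (b * m₁ + c * m₂) ≠ m₁ * m₂) :
    factorizations n (a * m₁ * m₂) = {![m₂, 0, 0], ![0, m₁, 0]} := by
  have h0 : n 0 = a * m₁ := by rw [hn]; rfl
  have h1 : n 1 = a * m₂ := by rw [hn]; rfl
  have h2 : n 2 = b * m₁ + c * m₂ := by rw [hn]; rfl
  ext z
  rw [mem_factorizations, Set.mem_insert_iff, Set.mem_singleton_iff, h0, h1, h2]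
  constructor
  · intro e
    have hdvd : a ∣ z 2 := by
      refine han.dvd_of_dvd_mul_right
        ((Nat.dvd_add_right (b := z 0 * (a * m₁) + z 1 * (a * m₂)) ?_).mp ?_)
      · exact ⟨z 0 * m₁ + z 1 * m₂, by ring⟩
      · rw [e, mul_assoc]
        exact dvd_mul_right _ _
    obtain ⟨t, ht⟩ := hdvd
    have e' : z 0 * m₁ + z 1 * m₂ + t * (b * m₁ + c * m₂) = m₁ * m₂ := by
      apply Nat.eq_of_mul_eq_mul_left ha
      rw [ht] at e
      rw [← mul_assoc a m₁ m₂, ← e]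
      ring
    rcases t with _ | t
    · rw [zero_mul, add_zero] at e'
      rcases eq_of_mul_add_mul_eq_mul hm₁ hm₂ hm e' with ⟨hz0, hz1⟩ | ⟨hz0, hz1⟩
      · left
        ext i
        fin_cases i
        exacts [hz0, hz1, by simpa using ht]
      · right
        ext i
        fin_cases i
        exacts [hz0, hz1, by simpa using ht]
    · exfalso
      apply hno (z 0 + t * b) (z 1 + t * c)
      rw [← e']
      ring
  · rintro (rfl | rfl)
    · simp; ring
    · simp; ring

lemma coprime_of_gluing (hg : ∀ t, (∀ i, t ∣ n i) → t = 1)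
    (hn : n = ![a * m₁, a * m₂, b * m₁ + c * m₂]) : a.Coprime (b * m₁ + c * m₂) := by
  refine hg _ fun i => ?_
  rw [hn]
  fin_cases i
  · exact (Nat.gcd_dvd_left _ _).mul_right _
  · exact (Nat.gcd_dvd_left _ _).mul_right _
  · exact Nat.gcd_dvd_right _ _

lemma exists_isTwoBettiBasis (hi : IsIndecomposable n) (hg : ∀ t, (∀ i, t ∣ n i) → t = 1)
    (hn : n = ![a * m₁, a * m₂, b * m₁ + c * m₂]) (hm : m₁.Coprime m₂) (hlt : m₁ < m₂)
    (hno : ∀ x y, x * m₁ + y * m₂ + (b * m₁ + c * m₂) ≠ m₁ * m₂) :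
    ∃ v₁ v₂, IsTwoBettiBasis n v₁ v₂ := by
  have h0 : n 0 = a * m₁ := by rw [hn]; rfl
  have h1 : n 1 = a * m₂ := by rw [hn]; rfl
  have h2 : n 2 = b * m₁ + c * m₂ := by rw [hn]; rfl
  have hpos := hi.pos
  have han := coprime_of_gluing hg hn
  have ha : 0 < a := Nat.pos_of_mul_pos_right (h0 ▸ hpos 0)
  have hm₁ : 0 < m₁ := Nat.pos_of_mul_pos_left (h0 ▸ hpos 0)
  have hZ := factorizations_eq_pair ha hm₁ (by lia) hn hm han hno
  have ha2 : a ≠ 1 := by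
    rintro rfl
    exact hi 2 0 1 (by decide) (by decide) b c (by rw [h0, h1, h2]; ring)
  have hbc : 2 ≤ b + c := by
    by_contra hc
    have hp2 := hpos 2
    rw [h2] at hp2
    obtain ⟨rfl, rfl⟩ | ⟨rfl, rfl⟩ | ⟨rfl, rfl⟩ :
      (b = 0 ∧ c = 0) ∨ (b = 1 ∧ c = 0) ∨ (b = 0 ∧ c = 1) := by lia
    · simp at hp2
    · exact hi 0 2 2 (by decide) (by decide) a 0 (by rw [h0, h2]; ring)
    · exact hi 1 2 2 (by decide) (by decide) a 0 (by rw [h1, h2]; ring)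
  have hbetti : betti n = {a * m₁ * m₂, a * (b * m₁ + c * m₂)} := by
    refine (betti_subset_of_gluing ha hn hpos hm han).antisymm ?_
    rintro s (rfl | rfl)
    · have hz : ![m₂, 0, 0] ∈ factorizations n (a * m₁ * m₂) := by rw [hZ]; simp
      have hw : ![0, m₁, 0] ∈ factorizations n (a * m₁ * m₂) := by rw [hZ]; simp
      refine ⟨mem_semigroup_iff.mpr ⟨_, hz⟩,
        not_connected_of_isolated (z := ⟨_, hz⟩) (w := ⟨_, hw⟩) ?_ ?_⟩
      · intro h
        have := congrFun (congrArg Subtype.val h) 1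
        simp at this
        lia
      · rintro ⟨y, hy⟩ ⟨i, hi, hi'⟩
        have hy' := hy
        rw [hZ] at hy'
        rcases hy' with rfl | rfl
        · rfl
        · exfalso
          fin_cases i <;> simp at hi hi'
    · exact mul_last_mem_betti ha hn hpos han
  obtain ⟨k, hk, hmin⟩ := exists_minimal_shift a b c m₁ m₂
  refine ⟨_, _, ?_, a, b, c, m₁, m₂, by lia, hbc, hlt, hn, hZ, rfl, k, hk, hmin, rfl⟩
  rw [hbetti]
  refine Set.ncard_pair fun h => hno 0 0 ?_
  rw [mul_assoc] at h
  simpa using (Nat.eq_of_mul_eq_mul_left ha h).symm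

end

/-- Some reordering of the generators admits chosen vectors. -/
def HasChosenBasis (n : Fin 3 → ℕ) : Prop :=
  ∃ (π : Equiv.Perm (Fin 3)) (v₁ v₂ : Fin 3 → ℤ), IsChosenBasis (n ∘ π) v₁ v₂

lemma HasChosenBasis.of_comp_perm {n : Fin 3 → ℕ} (σ : Equiv.Perm (Fin 3))
    (h : HasChosenBasis (n ∘ σ)) : HasChosenBasis n := by
  obtain ⟨π, v₁, v₂, h⟩ := h
  exact ⟨π.trans σ, v₁, v₂, h⟩

lemma exists_isSingleBettiBasis {s₁ s₂ s₃ : ℕ} (h3 : 0 < s₃) (h32 : s₃ < s₂) (h21 : s₂ < s₁)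
    (c12 : s₁.Coprime s₂) (c13 : s₁.Coprime s₃) (c23 : s₂.Coprime s₃) :
    ∃ v₁ v₂, IsSingleBettiBasis ![s₂ * s₃, s₁ * s₃, s₁ * s₂] v₁ v₂ := by
  refine ⟨_, _, ?_, s₁, s₂, s₃, h3, h32, h21, c12, c13, c23, rfl, rfl, rfl⟩
  have hn : ![s₂ * s₃, s₁ * s₃, s₁ * s₂] = ![s₃ * s₂, s₃ * s₁, s₁ * s₂ + 0 * s₁] := by
    rw [mul_comm s₂ s₃, mul_comm s₁ s₃, zero_mul, add_zero]
  have hpos : ∀ i, 0 < ![s₂ * s₃, s₁ * s₃, s₁ * s₂] i := by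
    have : 0 < s₁ := by lia
    have : 0 < s₂ := by lia
    intro i
    fin_cases i <;> simp <;> lia
  have hc : s₃.Coprime (s₁ * s₂ + 0 * s₁) := by
    rw [zero_mul, add_zero]
    exact Nat.Coprime.mul_right c13.symm c23.symm
  have hsub := betti_subset_of_gluing h3 hn hpos c12.symm hc
  have hmem := mul_last_mem_betti h3 hn hpos hc
  -- The two candidate Betti elements of the gluing coincide.
  have e : s₃ * s₂ * s₁ = s₃ * (s₁ * s₂ + 0 * s₁) := by ring
  rw [e, Set.pair_eq_singleton] at hsub
  rw [hsub.antisymm (Set.singleton_subset_iff.mpr hmem), Set.ncard_singleton]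

lemma hasChosenBasis_of_coprime {n t : Fin 3 → ℕ} (hinj : Function.Injective t)
    (hpos : ∀ i, 0 < t i) (hc : ∀ i j, i ≠ j → (t i).Coprime (t j))
    (hn : ∀ i, n i * t i = t 0 * t 1 * t 2) : HasChosenBasis n := by
  obtain ⟨π, h10, h21⟩ : ∃ π : Equiv.Perm (Fin 3), t (π 1) < t (π 0) ∧ t (π 2) < t (π 1) := by
    have hmono := Tuple.monotone_sort t
    have hstr : StrictMono (t ∘ Tuple.sort t) :=
      hmono.strictMono_of_injective (hinj.comp (Tuple.sort t).injective)
    exact ⟨Fin.revPerm.trans (Tuple.sort t), hstr (a := 1) (b := 2) (by decide),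
      hstr (a := 0) (b := 1) (by decide)⟩
  have hprod : t 0 * t 1 * t 2 = t (π 0) * t (π 1) * t (π 2) := by
    rw [← Fin.prod_univ_three, ← Fin.prod_univ_three (fun i => t (π i)), Equiv.prod_comp π t]
  have hne := fun i j (h : i ≠ j) => π.injective.ne h
  obtain ⟨v₁, v₂, h⟩ := exists_isSingleBettiBasis (hpos (π 2)) h21 h10
    (hc _ _ (hne 0 1 (by decide))) (hc _ _ (hne 0 2 (by decide))) (hc _ _ (hne 1 2 (by decide)))
  refine ⟨π, v₁, v₂, Or.inl ?_⟩
  convert h using 1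
  ext i
  apply Nat.eq_of_mul_eq_mul_right (hpos (π i))
  change n (π i) * t (π i) = _
  rw [hn, hprod]
  fin_cases i <;> simp <;> ring

section
variable {n : Fin 3 → ℕ} {a b c m₁ m₂ : ℕ}

lemma gluing_comp_swap (hn : n = ![a * m₁, a * m₂, b * m₁ + c * m₂]) :
    n ∘ Equiv.swap 0 1 = ![a * m₂, a * m₁, c * m₂ + b * m₁] := by
  ext i
  rw [hn]
  fin_cases i
  · rfl
  · rfl
  · exact add_comm _ _

lemma forall_dvd_comp_perm (hg : ∀ t, (∀ i, t ∣ n i) → t = 1) (π : Equiv.Perm (Fin 3)) :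
    ∀ t, (∀ i, t ∣ (n ∘ π) i) → t = 1 :=
  fun t ht => hg t fun i => by simpa using ht (π.symm i)

lemma hasChosenBasis_of_forall_ne (hi : IsIndecomposable n)
    (hg : ∀ t, (∀ i, t ∣ n i) → t = 1)
    (hn : n = ![a * m₁, a * m₂, b * m₁ + c * m₂]) (hm : m₁.Coprime m₂)
    (hno : ∀ x y, x * m₁ + y * m₂ + (b * m₁ + c * m₂) ≠ m₁ * m₂) : HasChosenBasis n := by
  rcases lt_trichotomy m₁ m₂ with h | h | h
  · obtain ⟨v₁, v₂, h⟩ := exists_isTwoBettiBasis hi hg hn hm h hno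
    exact ⟨Equiv.refl _, v₁, v₂, Or.inr h⟩
  · exfalso
    refine hi 0 1 1 (by decide) (by decide) 1 0 ?_
    rw [hn, h]
    simp
  · obtain ⟨v₁, v₂, h⟩ := exists_isTwoBettiBasis (hi.comp_perm (Equiv.swap 0 1))
      (forall_dvd_comp_perm hg _) (gluing_comp_swap hn) hm.symm h
      (fun x y e => hno y x (by rw [mul_comm m₁ m₂, ← e]; ring))
    exact ⟨Equiv.swap 0 1, v₁, v₂, Or.inr h⟩

/-- For `b = m₂` the generators are the pairwise products of `m₂, m₁, a`, which is form (1). For `b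
< m₂` the first and third generators are regrouped over their common factor `m₁`, as `(m₁ a, m₁ b,
m₂ a)`; then `m₂ > b` excludes a further factorization of `m₁ a b`. -/
lemma hasChosenBasis_of_multiple (hi : IsIndecomposable n)
    (hg : ∀ t, (∀ i, t ∣ n i) → t = 1)
    (hn : n = ![a * m₁, a * m₂, b * m₁ + 0 * m₂]) (hm : m₁.Coprime m₂) (hb : b ≤ m₂) :
    HasChosenBasis n := by
  have h0 : n 0 = a * m₁ := by rw [hn]; rfl
  have h1 : n 1 = a * m₂ := by rw [hn]; rfl
  have h2 : n 2 = b * m₁ := by rw [hn]; simp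
  have han := coprime_of_gluing hg hn
  rw [zero_mul, add_zero] at han
  have ha : 0 < a := Nat.pos_of_mul_pos_right (h0 ▸ hi.pos 0)
  have hm₁ : 0 < m₁ := Nat.pos_of_mul_pos_left (h0 ▸ hi.pos 0)
  have hb0 : 0 < b := Nat.pos_of_mul_pos_right (h2 ▸ hi.pos 2)
  have hab : a.Coprime b := han.coprime_mul_right_right
  have ham : a.Coprime m₁ := han.coprime_mul_left_right
  rcases hb.eq_or_lt with rfl | hlt
  · have hne : ∀ i j, i ≠ j → n i ≠ n j := fun i j hij h =>
      hi i j j hij hij 1 0 (by rw [h]; ring)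
    have d1 : b ≠ m₁ := fun h => hne 0 1 (by decide) (by rw [h0, h1, h])
    have d2 : b ≠ a := fun h => hne 0 2 (by decide) (by rw [h0, h2, h])
    have d3 : m₁ ≠ a := fun h => hne 1 2 (by decide) (by rw [h1, h2, h, mul_comm])
    refine hasChosenBasis_of_coprime (t := ![b, m₁, a]) ?_ ?_ ?_ ?_
    · intro i j h
      fin_cases i <;> fin_cases j <;> simp at h ⊢ <;> lia
    · intro i
      fin_cases i <;> simpa
    · intro i j h
      fin_cases i <;> fin_cases j <;> first | exact absurd rfl h | skip
      exacts [hm.symm, hab.symm, hm, ham.symm, hab, ham]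
    · intro i
      fin_cases i
      · simp [h0]; ring
      · simp [h1]; ring
      · simp [h2]
  · refine HasChosenBasis.of_comp_perm (Equiv.swap 1 2)
      (hasChosenBasis_of_forall_ne (a := m₁) (m₁ := a) (m₂ := b) (b := m₂) (c := 0)
        (hi.comp_perm _) (forall_dvd_comp_perm hg _) ?_ hab ?_)
    · ext i
      fin_cases i
      · change n 0 = _
        rw [h0, mul_comm]; rfl
      · change n 2 = _
        rw [h2, mul_comm]; rfl
      · change n 1 = _
        rw [h1, mul_comm]; simp
    · intro x y e
      rcases eq_of_mul_add_mul_eq_mul (u := x + m₂) (v := y) ha hb0 hab (by rw [← e]; ring)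
        with h | h <;> lia

/-- The generators of a gluing can be reordered so that chosen vectors exist. -/
theorem hasChosenBasis_of_gluing (hi : IsIndecomposable n)
    (hg : ∀ t, (∀ i, t ∣ n i) → t = 1)
    (hn : n = ![a * m₁, a * m₂, b * m₁ + c * m₂]) (hm : m₁.Coprime m₂) : HasChosenBasis n := by
  by_cases hno : ∀ x y, x * m₁ + y * m₂ + (b * m₁ + c * m₂) ≠ m₁ * m₂
  · exact hasChosenBasis_of_forall_ne hi hg hn hm hno
  push Not at hno
  obtain ⟨x, y, e⟩ := hno
  have hm₁ : 0 < m₁ := Nat.pos_of_mul_pos_left (by have := hi.pos 0; rwa [hn] at this)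
  have hm₂ : 0 < m₂ := Nat.pos_of_mul_pos_left (by have := hi.pos 1; rwa [hn] at this)
  -- A third factorization of `a m₁ m₂` forces the third generator to be a multiple of `m₁` alone or
  -- of `m₂` alone.
  rcases eq_of_mul_add_mul_eq_mul (u := x + b) (v := y + c) hm₁ hm₂ hm (by rw [← e]; ring)
    with ⟨hx, hy⟩ | ⟨hx, hy⟩
  · obtain rfl : c = 0 := by lia
    exact hasChosenBasis_of_multiple hi hg hn hm (by lia)
  · obtain rfl : b = 0 := by lia
    exact HasChosenBasis.of_comp_perm (Equiv.swap 0 1)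
      (hasChosenBasis_of_multiple (hi.comp_perm _) (forall_dvd_comp_perm hg _)
        (gluing_comp_swap hn) hm.symm (by lia))

end
end DeltaThree

theorem mainTheorem1 (n : Fin 3 → ℕ)
    (hgcd : Finset.univ.gcd n = 1)
    (hmin : DeltaThree.IsMinimalGen n)
    (hsymm : DeltaThree.IsSymmetric (DeltaThree.semigroup n)) :
    (∃ (π : Equiv.Perm (Fin 3)) (v₁ v₂ : Fin 3 → ℤ), DeltaThree.IsChosenBasis (n ∘ π) v₁ v₂) ∧
    ∀ (π : Equiv.Perm (Fin 3)) (v₁ v₂ : Fin 3 → ℤ), DeltaThree.IsChosenBasis (n ∘ π) v₁ v₂ →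
      LinearIndependent ℤ ![v₁, v₂] ∧
      Submodule.span ℤ {v₁, v₂} = DeltaThree.relationLattice (n ∘ π) ∧
      0 < DeltaThree.ell v₁ ∧
      DeltaThree.deltaSet n =
        DeltaThree.Euc (DeltaThree.ell v₁).toNat (DeltaThree.ell v₂).natAbs \ {0} := by
  have hi := hmin.isIndecomposable
  have hg : ∀ t, (∀ i, t ∣ n i) → t = 1 := fun t ht =>
    Nat.dvd_one.mp (hgcd ▸ Finset.dvd_gcd fun i _ => ht i)
  constructor
  · obtain ⟨σ, a, m₁, m₂, b, c, hn, hm⟩ := DeltaThree.exists_gluing_of_isSymmetric hi hsymm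
    exact DeltaThree.HasChosenBasis.of_comp_perm σ (DeltaThree.hasChosenBasis_of_gluing
      (hi.comp_perm σ) (DeltaThree.forall_dvd_comp_perm hg σ) hn hm)
  · intro π v₁ v₂ h
    rw [← DeltaThree.deltaSet_comp_perm n π]
    rcases h with h | h
    · exact h.isEucBasis
    · exact h.isEucBasis (hi.comp_perm π).pos (DeltaThree.forall_dvd_comp_perm hg π)
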